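/- Let $N\ge 2$, write $x=(x',x_N)\in\mathbb R^{N-1}\times\mathbb R$, and for $\gamma\in\mathbb R$ let $P_\gamma=\{x\in\mathbb R^N: x_N>\gamma|x'|^2\}$, so that $P_0=\mathbb R^N_+$. Call $\Omega\subset\mathbb R^N$ *locally elliptic* if - $\Omega$ is a bounded domain (open, connected) with Lipschitz boundary and $0\in\partial\Omega$; near the origin $\Omega$ is the region $\{x_N>h(x')\}$ above the graph of a $C^\infty$ function $h$ with $h(0)=0$ and $\nabla h(0)=0$; - $\Omega\not\subset P_0$; - there are $\gamma_{\rm loc}\ge 0$ and $r>0$ with $\Omega\cap B_r(0)\subset P_{\gamma_{\rm loc}}$; - there is $\gamma<0$ with $\Omega\subset P_\gamma$. Then: 1. For every locally elliptic $\Omega$ there is a constant $C(\Omega)\ge 0$ such that for every $L>\sup_{x\in\overline\Omega}|x|$ and every $v\in H_0^1(\Omega)$, $$C(\Omega)\int_\Omega v^2\,dx+\int_\Omega|\nabla v|^2\,dx\ \ge\ \frac{N^2}{4}\int_\Omega\frac{v^2}{|x|^2}\,dx+\frac14\int_\Omega\frac{v^2}{|x|^2\log^2(L/|x|)}\,dx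 .$$ In particular both integrals on the right are finite. 2. The $L^2$ term cannot be removed in general: there are a locally elliptic $\Omega\subset\mathbb R^N$ and a function $v\in H_0^1(\Omega)$ such that, for every $L>\sup_{x\in\overline\Omega}|x|$, $$\int_\Omega|\nabla v|^2\,dx\ <\ \frac{N^2}{4}\int_\Omega\frac{v^2}{|x|^2}\,dx+\frac14\int_\Omega\frac{v^2}{|x|^2\log^2(L/|x|)}\,dx .$$ -/

import Mathlib

open MeasureTheory Filter Topology
open scoped ENNReal NNReal ContDiff

namespace BoundaryHardy

/-- The Euclidean space `ℝ^N`, `N = d + 1`, with coordinates `x = (x', x_N)`. -/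
abbrev E (d : ℕ) := EuclideanSpace ℝ (Fin (d + 1))

/-- The first `N - 1` coordinates `x'` of `x`. -/
def horiz {d : ℕ} (x : E d) : EuclideanSpace ℝ (Fin d) :=
  WithLp.toLp 2 fun i => x i.castSucc

/-- The last coordinate `x_N` of `x`. -/
def vert {d : ℕ} (x : E d) : ℝ := x (Fin.last d)

/-- The paraboloid `P_γ = {x : x_N > γ |x'|²}`; `P_0` is the half-space `x_N > 0`. -/
def paraboloid (d : ℕ) (γ : ℝ) : Set (E d) :=
  {x | γ * ‖horiz x‖ ^ 2 < vert x}

/-- Near every boundary point, and in suitable orthonormal coordinates (given by the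
linear isometry `T`), `Ω` is the region strictly above the graph of a Lipschitz function. -/
def HasLipschitzBoundary {d : ℕ} (Ω : Set (E d)) : Prop :=
  ∀ p ∈ frontier Ω, ∃ r > 0, ∃ T : E d ≃ₗᵢ[ℝ] E d,
    ∃ K : ℝ≥0, ∃ φ : EuclideanSpace ℝ (Fin d) → ℝ, LipschitzWith K φ ∧
      ∀ x ∈ Metric.ball p r, x ∈ Ω ↔ φ (horiz (T x)) < vert (T x)

/-- Near the origin the boundary of `Ω` is the smooth graph `x_N = h(x')` over its tangent
hyperplane `x_N = 0` at the origin, and `Ω` lies above it. -/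
def HasSmoothBoundaryAtOrigin {d : ℕ} (Ω : Set (E d)) : Prop :=
  ∃ r > 0, ∃ h : EuclideanSpace ℝ (Fin d) → ℝ, ContDiff ℝ ∞ h ∧ h 0 = 0 ∧ fderiv ℝ h 0 = 0 ∧
    ∀ x ∈ Metric.ball (0 : E d) r, x ∈ Ω ↔ h (horiz x) < vert x

/-- Locally elliptic domains: bounded Lipschitz domains with the origin on their boundary, which
is smooth there, that are not contained in the half-space `P_0`, are contained near the origin
in some `P_γ` with `γ ≥ 0`, and are contained globally in some `P_γ` with `γ < 0`. -/
structure IsLocallyElliptic {d : ℕ} (Ω : Set (E d)) : Prop where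
  isOpen : IsOpen Ω
  isConnected : IsConnected Ω
  isBounded : Bornology.IsBounded Ω
  origin_mem : (0 : E d) ∈ frontier Ω
  lipschitz : HasLipschitzBoundary Ω
  smooth : HasSmoothBoundaryAtOrigin Ω
  not_subset : ¬ Ω ⊆ paraboloid d 0
  locally_subset : ∃ γ : ℝ, 0 ≤ γ ∧ ∃ r > 0, Ω ∩ Metric.ball 0 r ⊆ paraboloid d γ
  globally_subset : ∃ γ : ℝ, γ < 0 ∧ Ω ⊆ paraboloid d γ

/-- Test functions `φ ∈ C_c^∞(Ω)`. -/
def IsTestFunction {d : ℕ} (Ω : Set (E d)) (φ : E d → ℝ) : Prop :=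
  ContDiff ℝ ∞ φ ∧ HasCompactSupport φ ∧ tsupport φ ⊆ Ω

/-- `v ∈ H¹(Ω)` with weak gradient `g`. -/
def IsH1 {d : ℕ} (Ω : Set (E d)) (v : E d → ℝ) (g : E d → E d) : Prop :=
  MemLp v 2 (volume.restrict Ω) ∧ MemLp g 2 (volume.restrict Ω) ∧
    ∀ φ, IsTestFunction Ω φ → ∫ x in Ω, v x • gradient φ x = -∫ x in Ω, φ x • g x

/-- `v ∈ H₀¹(Ω)` with weak gradient `g`: `v ∈ H¹(Ω)` is a limit, in the norm of `H¹(Ω)`,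
of test functions. -/
def IsH10 {d : ℕ} (Ω : Set (E d)) (v : E d → ℝ) (g : E d → E d) : Prop :=
  IsH1 Ω v g ∧ ∃ φ : ℕ → E d → ℝ, (∀ k, IsTestFunction Ω (φ k)) ∧
    Tendsto (fun k => eLpNorm (φ k - v) 2 (volume.restrict Ω)) atTop (𝓝 0) ∧
    Tendsto (fun k => eLpNorm (gradient (φ k) - g) 2 (volume.restrict Ω)) atTop (𝓝 0)

/-- `∫_Ω f dx ∈ [0, ∞]`, for a function `f ≥ 0`. -/
noncomputable def integ {d : ℕ} (Ω : Set (E d)) (f : E d → ℝ) : ℝ≥0∞ :=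
  ∫⁻ x in Ω, ENNReal.ofReal (f x)

/-- The right-hand side
`(N²/4) ∫_Ω v²/|x|² dx + (1/4) ∫_Ω v²/(|x|² log²(L/|x|)) dx ∈ [0, ∞]`. -/
noncomputable def hardySide {d : ℕ} (Ω : Set (E d)) (L : ℝ) (v : E d → ℝ) : ℝ≥0∞ :=
  ENNReal.ofReal (((d : ℝ) + 1) ^ 2 / 4) * integ Ω (fun x => v x ^ 2 / ‖x‖ ^ 2) +
    ENNReal.ofReal (1 / 4) *
      integ Ω (fun x => v x ^ 2 / (‖x‖ ^ 2 * Real.log (L / ‖x‖) ^ 2))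

end BoundaryHardy

namespace BoundaryHardy

open scoped Gradient RealInnerProductSpace

/-! Part 1 combines a ground-state argument with localization. For b ∈ {0, 1} put A = N - 2 + 2b and
w = x_N^b |x|^(-A/2) log(L/|x|)^(1/2). Then -Δw/w is A²/(4|x|²) plus the logarithmic weight, so
expanding |∇φ - φ ∇w/w|² ≥ 0 and integrating the divergence terms away gives a Hardy inequality
(`integral_hardy_le`). With b = 1 the constant is N²/4, but x_N must not vanish on the support; with
b = 0 it is only (N-2)²/4, and only the origin must be avoided.

A locally elliptic domain satisfies x_N > 0 near the origin. A test function is therefore split as φ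
cos θ + φ sin θ, the first piece living near 0 (b = 1) and the second away from 0 (b = 0). Replacing
(N-2)²/4 by N²/4 in the second piece, and the gradient of θ, both cost a multiple of ∫φ², and this
produces C(Ω). Fatou's lemma carries the bound from test functions to H₀¹.

Part 2 rests on the fact that N²/4 = (N-2)²/4 + (N-1), where N - 1 is the first Dirichlet eigenvalue
of a hemisphere, with eigenfunction s = x_N/|x|. On the larger cap s > -1/2 the eigenvalue is
smaller. Hence in the cone over that cap a product Y(s) |x|^(-(N-2)/2) ψ(log|x|), with ψ spread over
a long interval so that its own Rayleigh quotient is negligible, violates the inequality with N²/4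
(`exists_axial_integral_lt`). This function vanishes near the origin and near infinity, so its
support fits into a domain that is flat at the origin and dips below x_N = 0 farther out
(`exists_isLocallyElliptic_superset`). -/

theorem contDiff_mul_of_contDiffAt {V : Type*} [NormedAddCommGroup V] [NormedSpace ℝ V]
    {n : WithTop ℕ∞} {f a : V → ℝ} (hf : ContDiff ℝ n f)
    (ha : ∀ x ∈ tsupport f, ContDiffAt ℝ n a x) : ContDiff ℝ n fun x => f x * a x := by
  refine contDiff_iff_contDiffAt.2 fun x => ?_
  by_cases hx : x ∈ tsupport f
  · exact hf.contDiffAt.mul (ha x hx)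
  · refine (contDiffAt_const (c := (0 : ℝ))).congr_of_eventuallyEq ?_
    filter_upwards [notMem_tsupport_iff_eventuallyEq.1 hx] with y hy
    simp [hy]

theorem fderiv_eq_zero_of_notMem_tsupport {V : Type*} [NormedAddCommGroup V] [NormedSpace ℝ V]
    {f : V → ℝ} {x : V} (hx : x ∉ tsupport f) : fderiv ℝ f x = 0 := by
  have := (notMem_tsupport_iff_eventuallyEq.1 hx).fderiv_eq (𝕜 := ℝ)
  rw [this]; simp

/-! ### Integration by parts for compactly supported functions -/

section Integration

variable {V : Type*} [NormedAddCommGroup V] [InnerProductSpace ℝ V] [FiniteDimensional ℝ V]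
  [MeasurableSpace V] [BorelSpace V]

theorem integrable_fderiv_apply {u : V → ℝ} (hu : ContDiff ℝ 1 u) (hc : HasCompactSupport u)
    {F : V → V} (hF : Continuous F) : Integrable fun x => fderiv ℝ u x (F x) := by
  refine Continuous.integrable_of_hasCompactSupport ?_ ?_
  · exact (hu.continuous_fderiv one_ne_zero).clm_apply hF
  · refine (hc.fderiv ℝ).mono ?_
    intro x hx h
    exact hx (by simp [h])

theorem integral_fderiv_apply_eq_zero {u : V → ℝ} (hu : ContDiff ℝ 1 u)
    (hc : HasCompactSupport u) (e : V) : ∫ x, fderiv ℝ u x e = 0 := by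
  have h := integral_mul_fderiv_eq_neg_fderiv_mul_of_integrable (μ := (volume : Measure V))
    (f := fun _ => (1 : ℝ)) (g := u) (v := e) (by simp)
    (by simpa using integrable_fderiv_apply hu hc (F := fun _ => e) continuous_const)
    (by simpa using hu.continuous.integrable_of_hasCompactSupport hc)
    (by intros; fun_prop) (fun x _ => hu.differentiable one_ne_zero x)
  simpa using h

end Integration

theorem norm_gradient {V : Type*} [NormedAddCommGroup V] [InnerProductSpace ℝ V]
    [CompleteSpace V] (u : V → ℝ) (x : V) : ‖∇ u x‖ = ‖fderiv ℝ u x‖ := by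
  simp [gradient]

theorem continuous_gradient {V : Type*} [NormedAddCommGroup V] [InnerProductSpace ℝ V]
    [CompleteSpace V] {u : V → ℝ} (hu : ContDiff ℝ 1 u) : Continuous (∇ u) := by
  unfold gradient
  exact (LinearIsometryEquiv.continuous _).comp (hu.continuous_fderiv one_ne_zero)

theorem hasCompactSupport_gradient {V : Type*} [NormedAddCommGroup V] [InnerProductSpace ℝ V]
    [CompleteSpace V] {u : V → ℝ} (hc : HasCompactSupport u) : HasCompactSupport (∇ u) := by
  refine (hc.fderiv ℝ).mono ?_
  intro x hx h
  exact hx (by simp [gradient, h])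

variable {d : ℕ}

/-- The integrand is the divergence of the compactly supported field u(x) x. -/
theorem integral_euler {u : E d → ℝ} (hu : ContDiff ℝ 1 u) (hc : HasCompactSupport u) :
    ∫ x, (((d : ℝ) + 1) * u x + fderiv ℝ u x x) = 0 := by
  have key : ∀ x : E d, ((d : ℝ) + 1) * u x + fderiv ℝ u x x =
      ∑ i : Fin (d + 1), fderiv ℝ (fun y : E d => y i * u y) x (EuclideanSpace.single i 1) := by
    intro x
    have h1 : ∀ i : Fin (d + 1),
        fderiv ℝ (fun y : E d => y i * u y) x (EuclideanSpace.single i 1) =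
          x i * fderiv ℝ u x (EuclideanSpace.single i 1) + u x := by
      intro i
      have hp : HasFDerivAt (fun y : E d => y i)
          (EuclideanSpace.proj i : E d →L[ℝ] ℝ) x :=
        (EuclideanSpace.proj i : E d →L[ℝ] ℝ).hasFDerivAt
      have := (hp.fun_mul (hu.differentiable one_ne_zero x).hasFDerivAt).fderiv
      rw [this]
      simp
    simp_rw [h1, Finset.sum_add_distrib]
    have h2 : x = ∑ i : Fin (d + 1), x i • EuclideanSpace.single i (1 : ℝ) := by
      ext j
      simp [Finset.sum_apply, Pi.single_apply]
    conv_lhs => rw [h2]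
    rw [map_sum]
    simp only [map_smul, smul_eq_mul, ← h2]
    simp
    ring
  have hci : ∀ i : Fin (d + 1), ContDiff ℝ 1 fun y : E d => y i * u y := fun i => by fun_prop
  have hsi : ∀ i : Fin (d + 1), HasCompactSupport fun y : E d => y i * u y :=
    fun i => hc.mul_left
  simp_rw [key]
  rw [integral_finsetSum]
  · exact Finset.sum_eq_zero fun i _ => integral_fderiv_apply_eq_zero (hci i) (hsi i) _
  · exact fun i _ => integrable_fderiv_apply (hci i) (hsi i) continuous_const

/-! ### Hardy inequalities from a ground state -/

/-- The unit vector `e_N`. -/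
noncomputable def eLast (d : ℕ) : E d := EuclideanSpace.single (Fin.last d) 1

theorem inner_eLast (x : E d) : ⟪eLast d, x⟫ = vert x := by
  simp [eLast, vert, EuclideanSpace.inner_single_left]

theorem norm_eLast : ‖eLast d‖ = 1 := by simp [eLast]

theorem vert_eLast : vert (eLast d) = 1 := by simp [eLast, vert]

theorem contDiff_vert {n : WithTop ℕ∞} : ContDiff ℝ n (vert : E d → ℝ) := by
  unfold vert; fun_prop

theorem hasFDerivAt_vert (x : E d) : HasFDerivAt (vert : E d → ℝ) (innerSL ℝ (eLast d)) x := by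
  have : (vert : E d → ℝ) = innerSL ℝ (eLast d) := by
    ext y; simp [inner_eLast]
  rw [this]
  exact ContinuousLinearMap.hasFDerivAt _

theorem hasFDerivAt_comp_norm {V : Type*} [NormedAddCommGroup V] [InnerProductSpace ℝ V]
    {α : ℝ → ℝ} {α' : ℝ} {x : V} (hx : x ≠ 0) (hα : HasDerivAt α α' ‖x‖) :
    HasFDerivAt (fun y => α ‖y‖) ((α' / ‖x‖) • innerSL ℝ x) x := by
  have hpos : 0 < ‖x‖ := norm_pos_iff.2 hx
  have h1 : HasFDerivAt (fun y : V => ‖y‖ ^ 2) (2 • innerSL ℝ x) x :=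
    (hasStrictFDerivAt_norm_sq x).hasFDerivAt
  have h2 : HasFDerivAt (fun y : V => √(‖y‖ ^ 2)) ((1 / (2 * √(‖x‖ ^ 2))) • (2 • innerSL ℝ x)) x :=
    h1.sqrt (by positivity)
  have h3 : HasFDerivAt (fun y : V => ‖y‖) ((1 / ‖x‖) • innerSL ℝ x) x := by
    simp only [Real.sqrt_sq (norm_nonneg _)] at h2
    refine h2.congr_fderiv ?_
    ext y
    simp
    field_simp
  refine (hα.comp_hasFDerivAt x h3).congr_fderiv ?_
  rw [smul_smul, mul_one_div]

theorem hasDerivAt_hardyWeight {A L r : ℝ} (hr : 0 < r) (hL : r < L) :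
    HasDerivAt (fun t : ℝ => (t ^ 2)⁻¹ * (A / 2 + (2 * Real.log (L / t))⁻¹))
      (-(2 / r ^ 3) * (A / 2 + (2 * Real.log (L / r))⁻¹) +
        (r ^ 3)⁻¹ * (2 * Real.log (L / r) ^ 2)⁻¹) r := by
  have hl : 0 < Real.log (L / r) := Real.log_pos ((one_lt_div hr).2 hL)
  have hL0 : 0 < L := hr.trans hL
  have h1 : HasDerivAt (fun t : ℝ => (t ^ 2)⁻¹) (-(2 * r) / (r ^ 2) ^ 2) r := by
    simpa using (hasDerivAt_pow 2 r).fun_inv (by positivity)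
  have h2 : HasDerivAt (fun t : ℝ => L / t) (-L / r ^ 2) r := by
    have := (hasDerivAt_inv hr.ne').const_mul L
    simpa only [div_eq_mul_inv, neg_mul, mul_neg] using this
  have h3 := ((h2.log (by positivity)).const_mul 2).fun_inv (by positivity)
  refine (h1.mul (h3.const_add (A / 2))).congr_deriv ?_
  field_simp

theorem fderiv_sq_mul_eq_zero_of_notMem {V : Type*} [NormedAddCommGroup V] [NormedSpace ℝ V]
    {f a : V → ℝ} {x : V} (hx : x ∉ tsupport f) :
    fderiv ℝ (fun y => f y ^ 2 * a y) x = 0 := by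
  refine fderiv_eq_zero_of_notMem_tsupport fun h => hx ?_
  refine closure_mono ?_ h
  intro y hy h0
  exact hy (by simp [h0])

theorem hasCompactSupport_sq_mul {V : Type*} [NormedAddCommGroup V]
    {f a : V → ℝ} (hc : HasCompactSupport f) : HasCompactSupport fun y => f y ^ 2 * a y := by
  refine hc.mono ?_
  intro y hy h0
  exact hy (by simp [h0])

theorem tsupport_sq_subset {V : Type*} [NormedAddCommGroup V] {f : V → ℝ} :
    tsupport (fun y => f y ^ 2) ⊆ tsupport f := by
  refine closure_mono ?_
  intro y hy h0
  exact hy (by simp [h0])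

/-- The Hardy inequality with logarithmic remainder: in the whole space for `b = 0`, and in the
half-space for `b = 1`. -/
theorem integral_hardy_le {L b : ℝ} (hb : b * b = b) {φ : E d → ℝ} (hφ : ContDiff ℝ 1 φ)
    (hc : HasCompactSupport φ) (h0 : ∀ x ∈ tsupport φ, x ≠ 0 ∧ ‖x‖ < L)
    (hv : ∀ x ∈ tsupport φ, b = 0 ∨ vert x ≠ 0) :
    Integrable (fun x => φ x ^ 2 * (((d - 1 + 2 * b) ^ 2 / 4) / ‖x‖ ^ 2 +
      1 / 4 / (‖x‖ ^ 2 * Real.log (L / ‖x‖) ^ 2))) ∧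
    ∫ x, φ x ^ 2 * (((d - 1 + 2 * b) ^ 2 / 4) / ‖x‖ ^ 2 +
      1 / 4 / (‖x‖ ^ 2 * Real.log (L / ‖x‖) ^ 2)) ≤ ∫ x, ‖∇ φ x‖ ^ 2 := by
  -- The field a x - ν e_N built from these functions is -∇w/w for w = x_N^b |x|^(-A/2)
  -- log(L/|x|)^(1/2).
  set A : ℝ := d - 1 + 2 * b with hA
  set W : E d → ℝ := fun x => (A ^ 2 / 4) / ‖x‖ ^ 2 +
      1 / 4 / (‖x‖ ^ 2 * Real.log (L / ‖x‖) ^ 2) with hW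
  set α : ℝ → ℝ := fun t => (t ^ 2)⁻¹ * (A / 2 + (2 * Real.log (L / t))⁻¹) with hα
  set a : E d → ℝ := fun x => α ‖x‖ with ha
  set ν : E d → ℝ := fun x => b / vert x with hν
  have hlog : ∀ x ∈ tsupport φ, 0 < Real.log (L / ‖x‖) := fun x hx =>
    Real.log_pos ((one_lt_div (norm_pos_iff.2 (h0 x hx).1)).2 (h0 x hx).2)
  have hLpos : ∀ x ∈ tsupport φ, 0 < L / ‖x‖ := fun x hx =>
    div_pos ((norm_nonneg x).trans_lt (h0 x hx).2) (norm_pos_iff.2 (h0 x hx).1)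
  have hWc : ∀ x ∈ tsupport (fun y => φ y ^ 2), ContDiffAt ℝ 1 W x := by
    intro x hx'
    have hx := tsupport_sq_subset hx'
    have hn := contDiffAt_norm (n := 1) ℝ (h0 x hx).1
    have hp := norm_pos_iff.2 (h0 x hx).1
    have hl := hlog x hx
    have hLp := hLpos x hx
    have h1 : ContDiffAt ℝ 1 (fun y : E d => Real.log (L / ‖y‖)) x :=
      (contDiffAt_const.div hn hp.ne').log hLp.ne'
    refine (contDiffAt_const.div (hn.pow 2) (by positivity)).add
      (contDiffAt_const.div ((hn.pow 2).mul (h1.pow 2)) (by positivity))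
  have hac : ∀ x ∈ tsupport (fun y => φ y ^ 2), ContDiffAt ℝ 1 a x := by
    intro x hx'
    have hx := tsupport_sq_subset hx'
    have hn := contDiffAt_norm (n := 1) ℝ (h0 x hx).1
    have hp := norm_pos_iff.2 (h0 x hx).1
    have hl := hlog x hx
    have hLp := hLpos x hx
    have h1 : ContDiffAt ℝ 1 (fun y : E d => Real.log (L / ‖y‖)) x :=
      (contDiffAt_const.div hn hp.ne').log hLp.ne'
    exact ((hn.pow 2).inv (by positivity)).mul
      (contDiffAt_const.add ((contDiffAt_const.mul h1).inv (by positivity)))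
  -- The derivative of b / x_N is -b / x_N², which equals -ν² exactly because b² = b.
  have hνd : ∀ x ∈ tsupport φ, ν x * vert x = b ∧ ContDiffAt ℝ 1 ν x ∧
      HasFDerivAt ν (-(ν x ^ 2) • innerSL ℝ (eLast d)) x := by
    intro x hx
    by_cases hb0 : b = 0
    · have : ν = fun _ => 0 := by ext y; simp [hν, hb0]
      rw [this]
      refine ⟨by simp [hb0], contDiffAt_const, ?_⟩
      simpa using hasFDerivAt_const (0 : ℝ) x
    · have hb1 : b = 1 := by
        have : b * (b - 1) = 0 := by linarith
        rcases mul_eq_zero.1 this with h | h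
        · exact absurd h hb0
        · linarith
      have hvx : vert x ≠ 0 := (hv x hx).resolve_left hb0
      refine ⟨by simp [hν, hvx], contDiffAt_const.div contDiff_vert.contDiffAt hvx, ?_⟩
      have h1 := ((hasDerivAt_inv hvx).comp_hasFDerivAt x (hasFDerivAt_vert x)).const_mul b
      refine (h1.congr_of_eventuallyEq (Eventually.of_forall fun y => ?_)).congr_fderiv ?_
      · simp [hν, div_eq_mul_inv]
      · simp [hν, hb1]
  have hφ2 : ContDiff ℝ 1 fun y => φ y ^ 2 := hφ.pow 2
  have hu := contDiff_mul_of_contDiffAt hφ2 hac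
  have huc : HasCompactSupport fun y => φ y ^ 2 * a y := hasCompactSupport_sq_mul hc
  have hw := contDiff_mul_of_contDiffAt hφ2
    (fun x hx => (hνd x (tsupport_sq_subset hx)).2.1)
  have hwc : HasCompactSupport fun y => φ y ^ 2 * ν y := hasCompactSupport_sq_mul hc
  have hWi : Integrable (fun x => φ x ^ 2 * W x) :=
    (contDiff_mul_of_contDiffAt hφ2 hWc).continuous.integrable_of_hasCompactSupport
      (hasCompactSupport_sq_mul hc)
  have hgi : Integrable fun x => ‖∇ φ x‖ ^ 2 := by
    refine ((continuous_gradient hφ).norm.pow 2).integrable_of_hasCompactSupport ?_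
    refine (hasCompactSupport_gradient hc).mono fun x hx h => hx (by simp [h])
  have hui : Integrable fun x => ((d : ℝ) + 1) * (φ x ^ 2 * a x) +
      fderiv ℝ (fun y => φ y ^ 2 * a y) x x :=
    ((hu.continuous.integrable_of_hasCompactSupport huc).const_mul _).add
      (integrable_fderiv_apply hu huc continuous_id)
  have hwi : Integrable fun x => fderiv ℝ (fun y => φ y ^ 2 * ν y) x (eLast d) :=
    integrable_fderiv_apply hw hwc continuous_const
  -- The difference of the two sides is the square |∇φ + φ (a x - ν e_N)|²; the fderiv terms make up
  -- divergences, which integrate to zero.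
  have key : ∀ x, φ x ^ 2 * W x ≤ ‖∇ φ x‖ ^ 2 + (((d : ℝ) + 1) * (φ x ^ 2 * a x) +
      fderiv ℝ (fun y => φ y ^ 2 * a y) x x) -
      fderiv ℝ (fun y => φ y ^ 2 * ν y) x (eLast d) := by
    intro x
    by_cases hx : x ∈ tsupport φ
    swap
    · rw [fderiv_sq_mul_eq_zero_of_notMem hx, fderiv_sq_mul_eq_zero_of_notMem hx,
        image_eq_zero_of_notMem_tsupport hx]
      simp
    have hp := norm_pos_iff.2 (h0 x hx).1
    have hl := hlog x hx
    obtain ⟨hq, -, hν'⟩ := hνd x hx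
    have hφd := (hφ.differentiable one_ne_zero x).hasFDerivAt
    have hsq : HasFDerivAt (fun y => φ y ^ 2) ((2 * φ x) • fderiv ℝ φ x) x := by
      simpa using hφd.pow 2
    have ha' := hasFDerivAt_comp_norm (h0 x hx).1 (hasDerivAt_hardyWeight (A := A) hp (h0 x hx).2)
    rw [(hsq.fun_mul ha').fderiv, (hsq.fun_mul hν').fderiv]
    have hsqn : ‖∇ φ x + φ x • (a x • x - ν x • eLast d)‖ ^ 2 = ‖∇ φ x‖ ^ 2 +
        2 * φ x * (a x * fderiv ℝ φ x x - ν x * fderiv ℝ φ x (eLast d)) +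
        φ x ^ 2 * (a x ^ 2 * ‖x‖ ^ 2 - 2 * a x * b + ν x ^ 2) := by
      rw [norm_add_sq_real, norm_smul, mul_pow, norm_sub_sq_real, inner_smul_right,
        inner_sub_right, inner_smul_right, inner_smul_right, inner_gradient_left,
        inner_gradient_left, inner_smul_left, inner_smul_right, real_inner_comm, inner_eLast,
        norm_smul, norm_smul, norm_eLast, mul_pow, mul_pow, ← hq]
      simp only [Real.norm_eq_abs, sq_abs, conj_trivial]
      ring
    have hnn : 0 ≤ ‖∇ φ x + φ x • (a x • x - ν x • eLast d)‖ ^ 2 := by positivity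
    rw [hsqn] at hnn
    have hee : ⟪eLast d, eLast d⟫ = (1 : ℝ) := by rw [inner_eLast, vert_eLast]
    simp only [add_apply, smul_apply, innerSL_apply_apply, smul_eq_mul, real_inner_self_eq_norm_sq, norm_eLast]
    rw [← sub_nonneg]
    refine hnn.trans (le_of_eq ?_)
    -- Riccati identity: for F = a x - ν e_N this is div F - |F|² = W, the two ν² terms having
    -- cancelled.
    have hWx : W x = ((d : ℝ) + 1 + 2 * b) * a x + (-(2 / ‖x‖ ^ 3) *
        (A / 2 + (2 * Real.log (L / ‖x‖))⁻¹) +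
        (‖x‖ ^ 3)⁻¹ * (2 * Real.log (L / ‖x‖) ^ 2)⁻¹) * ‖x‖ - a x ^ 2 * ‖x‖ ^ 2 := by
      have hd' : (d : ℝ) = A + 1 - 2 * b := by rw [hA]; ring
      simp only [hW, ha, hα]
      rw [hd']
      field_simp
      ring
    rw [hWx]
    simp only [ha, hα]
    field_simp
    ring
  refine ⟨hWi, ?_⟩
  have h1 : ∫ x, φ x ^ 2 * W x ≤ ∫ x, (‖∇ φ x‖ ^ 2 + (((d : ℝ) + 1) * (φ x ^ 2 * a x) +
      fderiv ℝ (fun y => φ y ^ 2 * a y) x x) -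
      fderiv ℝ (fun y => φ y ^ 2 * ν y) x (eLast d)) :=
    integral_mono hWi ((hgi.add hui).sub hwi) key
  have h2 := integral_sub (hgi.add hui) hwi
  simp only [Pi.add_apply] at h2
  rw [h2, integral_add hgi hui, integral_euler hu huc,
    integral_fderiv_apply_eq_zero hw hwc] at h1
  rw [add_zero, sub_zero] at h1
  exact h1

/-! ### Localization near the origin -/

theorem gradient_fun_mul {V : Type*} [NormedAddCommGroup V] [InnerProductSpace ℝ V]
    [CompleteSpace V] {f g : V → ℝ} {x : V} (hf : DifferentiableAt ℝ f x)
    (hg : DifferentiableAt ℝ g x) : ∇ (fun y => f y * g y) x = f x • ∇ g x + g x • ∇ f x := by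
  unfold gradient
  rw [fderiv_fun_mul hf hg]
  simp

/-- Since cos² + sin² = 1, the cross terms f ∇f·∇θ cancel and only f² |∇θ|² is lost. -/
theorem norm_gradient_cos_mul_sq_add {V : Type*} [NormedAddCommGroup V] [InnerProductSpace ℝ V]
    [CompleteSpace V] {θ f : V → ℝ} {x : V} (hθ : DifferentiableAt ℝ θ x)
    (hf : DifferentiableAt ℝ f x) :
    ‖∇ (fun y => Real.cos (θ y) * f y) x‖ ^ 2 + ‖∇ (fun y => Real.sin (θ y) * f y) x‖ ^ 2 =
      ‖∇ f x‖ ^ 2 + f x ^ 2 * ‖∇ θ x‖ ^ 2 := by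
  have h1 : ∇ (fun y => Real.cos (θ y)) x = -Real.sin (θ x) • ∇ θ x := by
    unfold gradient
    rw [fderiv_cos hθ]
    simp
  have h2 : ∇ (fun y => Real.sin (θ y)) x = Real.cos (θ x) • ∇ θ x := by
    unfold gradient
    rw [fderiv_sin hθ]
    simp
  rw [gradient_fun_mul hθ.cos hf, gradient_fun_mul hθ.sin hf, h1, h2]
  simp only [norm_add_sq_real, norm_smul, inner_smul_left, inner_smul_right, mul_pow,
    Real.norm_eq_abs, sq_abs, conj_trivial, neg_sq]
  linear_combination (‖∇ f x‖ ^ 2 + f x ^ 2 * ‖∇ θ x‖ ^ 2) * Real.sin_sq_add_cos_sq (θ x)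

/-- The weight on the right-hand side of the Hardy inequality. -/
noncomputable def weight (d : ℕ) (L : ℝ) (x : E d) : ℝ :=
  (((d : ℝ) + 1) ^ 2 / 4) / ‖x‖ ^ 2 + 1 / 4 / (‖x‖ ^ 2 * Real.log (L / ‖x‖) ^ 2)

theorem weight_nonneg (L : ℝ) (x : E d) : 0 ≤ weight d L x := by
  unfold weight; positivity

theorem norm_lt_of_sSup_lt {Ω : Set (E d)} (hΩ : Bornology.IsBounded Ω) {L : ℝ}
    (hL : sSup ((fun x => ‖x‖) '' closure Ω) < L) {x : E d} (hx : x ∈ Ω) : ‖x‖ < L := by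
  refine lt_of_le_of_lt (le_csSup ?_ (Set.mem_image_of_mem _ (subset_closure hx))) hL
  obtain ⟨R, hR⟩ := isBounded_iff_forall_norm_le.1 hΩ.closure
  exact ⟨R, by rintro _ ⟨y, hy, rfl⟩; exact hR y hy⟩

theorem IsLocallyElliptic.zero_notMem {Ω : Set (E d)} (hΩ : IsLocallyElliptic Ω) :
    (0 : E d) ∉ Ω := by
  have := hΩ.origin_mem
  rw [hΩ.isOpen.frontier_eq] at this
  exact this.2

/-- C must not depend on L, and the logarithmic weight blows up at |x| = L, so it cannot be absorbed
into C away from the origin. Both localized pieces therefore use a Hardy inequality with the full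
logarithmic term; only the |x|⁻² coefficient of the outer piece is too small. -/
theorem IsLocallyElliptic.exists_integral_le {Ω : Set (E d)} (hΩ : IsLocallyElliptic Ω) :
    ∃ C : ℝ≥0, ∀ L : ℝ, sSup ((fun x => ‖x‖) '' closure Ω) < L →
      ∀ φ : E d → ℝ, IsTestFunction Ω φ → Integrable (fun x => φ x ^ 2 * weight d L x) ∧
        ∫ x, φ x ^ 2 * weight d L x ≤ C * (∫ x, φ x ^ 2) + ∫ x, ‖∇ φ x‖ ^ 2 := by
  obtain ⟨γ, hγ, r, hr, hsub⟩ := hΩ.locally_subset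
  let f : ContDiffBump (0 : E d) := ⟨r / 4, r / 2, by positivity, by linarith⟩
  obtain ⟨K, hK⟩ := ContDiff.lipschitzWith_of_hasCompactSupport f.hasCompactSupport
    (f.contDiff (n := 1)) one_ne_zero
  set θ : E d → ℝ := fun x => Real.pi / 2 * (1 - f x) with hθ
  have hθc : ContDiff ℝ 1 θ := contDiff_const.mul (contDiff_const.sub f.contDiff)
  have hθK : ∀ x, ‖∇ θ x‖ ≤ Real.pi / 2 * K := by
    intro x
    have h1 : DifferentiableAt ℝ f x := (f.contDiff (n := 1)).differentiable one_ne_zero x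
    rw [norm_gradient, hθ, fderiv_const_mul (by fun_prop), norm_smul, fderiv_const_sub, norm_neg]
    rw [Real.norm_of_nonneg (by positivity)]
    gcongr
    exact norm_fderiv_le_of_lipschitz ℝ hK
  -- The first term bounds N²/(4|x|²) on |x| ≥ r/4, where the sine piece lives; the second bounds
  -- |∇θ|².
  refine ⟨(((d : ℝ) + 1) ^ 2 / 4 * (16 / r ^ 2) + (Real.pi / 2 * K) ^ 2).toNNReal, ?_⟩
  rw [Real.coe_toNNReal _ (by positivity)]
  intro L hL φ hφ
  obtain ⟨hφc, hφs, hφΩ⟩ := hφ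
  have hφ1 : ContDiff ℝ 1 φ := hφc.of_le (by simp)
  set φ₁ : E d → ℝ := fun x => Real.cos (θ x) * φ x with hφ₁
  set φ₂ : E d → ℝ := fun x => Real.sin (θ x) * φ x with hφ₂
  have hs₁ : tsupport φ₁ ⊆ tsupport φ := tsupport_mul_subset_right
  have hs₂ : tsupport φ₂ ⊆ tsupport φ := tsupport_mul_subset_right
  have hne : ∀ x ∈ tsupport φ, x ≠ 0 ∧ ‖x‖ < L := by
    intro x hx
    refine ⟨?_, norm_lt_of_sSup_lt hΩ.isBounded hL (hφΩ hx)⟩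
    rintro rfl
    exact hΩ.zero_notMem (hφΩ hx)
  have hs₁' : ∀ x ∈ tsupport φ₁, ‖x‖ ≤ r / 2 := by
    have : tsupport φ₁ ⊆ Metric.closedBall 0 (r / 2) := by
      refine closure_minimal ?_ Metric.isClosed_closedBall
      intro x hx
      by_contra h
      refine hx ?_
      have h0 : f x = 0 := f.zero_of_le_dist (by
        simp only [mem_closedBall_zero_iff, not_le] at h
        simpa using h.le)
      simp [hφ₁, hθ, h0]
    intro x hx
    simpa using this hx
  obtain ⟨hi₁, hI₁⟩ := integral_hardy_le (L := L) (b := 1) (by norm_num)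
    (show ContDiff ℝ 1 φ₁ from hθc.cos.mul hφ1) hφs.mul_left (fun x hx => hne x (hs₁ hx)) (by
      intro x hx
      right
      have h1 : x ∈ Ω ∩ Metric.ball 0 r := by
        refine ⟨hφΩ (hs₁ hx), ?_⟩
        have := hs₁' x hx
        simp only [mem_ball_zero_iff]
        linarith
      have h2 := hsub h1
      have h3 : γ * ‖horiz x‖ ^ 2 < vert x := h2
      have : 0 ≤ γ * ‖horiz x‖ ^ 2 := by positivity
      exact (this.trans_lt h3).ne')
  obtain ⟨hi₂, hI₂⟩ := integral_hardy_le (L := L) (b := 0) (by norm_num)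
    (show ContDiff ℝ 1 φ₂ from hθc.sin.mul hφ1) hφs.mul_left (fun x hx => hne x (hs₂ hx))
    (fun _ _ => Or.inl rfl)
  have hd : (d : ℝ) - 1 + 2 * 1 = d + 1 := by ring
  have hd' : (d : ℝ) - 1 + 2 * 0 = d - 1 := by ring
  rw [hd] at hi₁ hI₁
  rw [hd'] at hi₂ hI₂
  have hφi : Integrable fun x => φ x ^ 2 :=
    (hφ1.continuous.pow 2).integrable_of_hasCompactSupport
      (hφs.mono fun x hx h => hx (by simp [h]))
  have hsin : ∀ x, Real.sin (θ x) = 0 ∨ r / 4 ≤ ‖x‖ := by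
    intro x
    by_cases h : r / 4 ≤ ‖x‖
    · exact Or.inr h
    · left
      have h1 : f x = 1 := f.one_of_mem_closedBall (by
        simp only [mem_closedBall_zero_iff]
        exact (not_le.1 h).le)
      simp [hθ, h1]
  have hgi : ∀ ψ : E d → ℝ, ContDiff ℝ 1 ψ → HasCompactSupport ψ →
      Integrable fun x => ‖∇ ψ x‖ ^ 2 := fun ψ h h' =>
    ((continuous_gradient h).norm.pow 2).integrable_of_hasCompactSupport
      ((hasCompactSupport_gradient h').mono fun x hx h => hx (by simp [h]))
  have hg₁ := hgi φ₁ (hθc.cos.mul hφ1) hφs.mul_left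
  have hg₂ := hgi φ₂ (hθc.sin.mul hφ1) hφs.mul_left
  have hpw : ∀ x, φ x ^ 2 * weight d L x ≤
      φ₁ x ^ 2 * (((d : ℝ) + 1) ^ 2 / 4 / ‖x‖ ^ 2 + 1 / 4 / (‖x‖ ^ 2 * Real.log (L / ‖x‖) ^ 2)) +
      φ₂ x ^ 2 * (((d : ℝ) - 1) ^ 2 / 4 / ‖x‖ ^ 2 + 1 / 4 / (‖x‖ ^ 2 * Real.log (L / ‖x‖) ^ 2)) +
      ((d : ℝ) + 1) ^ 2 / 4 * (16 / r ^ 2) * φ x ^ 2 := by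
    intro x
    have e1 : φ x ^ 2 = φ₁ x ^ 2 + φ₂ x ^ 2 := by
      simp only [hφ₁, hφ₂]
      linear_combination -(φ x ^ 2) * Real.sin_sq_add_cos_sq (θ x)
    have e2 : φ₂ x ^ 2 * (((d : ℝ) + 1) ^ 2 / 4 / ‖x‖ ^ 2) ≤
        ((d : ℝ) + 1) ^ 2 / 4 * (16 / r ^ 2) * φ x ^ 2 := by
      rcases hsin x with h | h
      · have : φ₂ x = 0 := by simp [hφ₂, h]
        rw [this]
        have : 0 ≤ ((d : ℝ) + 1) ^ 2 / 4 * (16 / r ^ 2) * φ x ^ 2 := by positivity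
        simpa using this
      · have h3 : φ₂ x ^ 2 ≤ φ x ^ 2 := by rw [e1]; nlinarith [sq_nonneg (φ₁ x)]
        have h4 : ((d : ℝ) + 1) ^ 2 / 4 / ‖x‖ ^ 2 ≤ ((d : ℝ) + 1) ^ 2 / 4 * (16 / r ^ 2) := by
          have : ((d : ℝ) + 1) ^ 2 / 4 * (16 / r ^ 2) = ((d : ℝ) + 1) ^ 2 / 4 / (r / 4) ^ 2 := by
            field_simp
            norm_num
          rw [this]
          gcongr
        rw [mul_comm (((d : ℝ) + 1) ^ 2 / 4 * (16 / r ^ 2))]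
        gcongr
    have e3 : 0 ≤ φ₂ x ^ 2 * (((d : ℝ) - 1) ^ 2 / 4 / ‖x‖ ^ 2) := by positivity
    unfold weight
    generalize ((d : ℝ) + 1) ^ 2 / 4 / ‖x‖ ^ 2 = X at *
    generalize ((d : ℝ) - 1) ^ 2 / 4 / ‖x‖ ^ 2 = Y at *
    have e4 : φ x ^ 2 * (X + 1 / 4 / (‖x‖ ^ 2 * Real.log (L / ‖x‖) ^ 2)) =
        φ₁ x ^ 2 * (X + 1 / 4 / (‖x‖ ^ 2 * Real.log (L / ‖x‖) ^ 2)) + φ₂ x ^ 2 * X +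
        φ₂ x ^ 2 * (1 / 4 / (‖x‖ ^ 2 * Real.log (L / ‖x‖) ^ 2)) := by
      rw [e1]; ring
    rw [e4, mul_add (φ₂ x ^ 2)]
    linarith
  have hmeas : AEStronglyMeasurable (fun x => φ x ^ 2 * weight d L x) volume := by
    refine ((hφ1.continuous.pow 2).measurable.mul ?_).aestronglyMeasurable
    unfold weight
    fun_prop
  have hsum := (hi₁.add hi₂).add (hφi.const_mul (((d : ℝ) + 1) ^ 2 / 4 * (16 / r ^ 2)))
  have hint : Integrable (fun x => φ x ^ 2 * weight d L x) := by
    refine hsum.mono' hmeas (Eventually.of_forall fun x => ?_)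
    rw [Real.norm_of_nonneg (mul_nonneg (sq_nonneg _) (weight_nonneg L x))]
    exact hpw x
  refine ⟨hint, ?_⟩
  have hgg : ∀ x, ‖∇ φ₁ x‖ ^ 2 + ‖∇ φ₂ x‖ ^ 2 ≤
      ‖∇ φ x‖ ^ 2 + (Real.pi / 2 * K) ^ 2 * φ x ^ 2 := by
    intro x
    rw [hφ₁, hφ₂, norm_gradient_cos_mul_sq_add (hθc.differentiable one_ne_zero x)
      (hφ1.differentiable one_ne_zero x), mul_comm (φ x ^ 2)]
    gcongr
    exact hθK x
  have h1 := integral_mono hint hsum hpw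
  have h2 := integral_mono (hg₁.add hg₂) ((hgi φ hφ1 hφs).add (hφi.const_mul _)) hgg
  have h3 := integral_add (hi₁.add hi₂) (hφi.const_mul (((d : ℝ) + 1) ^ 2 / 4 * (16 / r ^ 2)))
  simp only [Pi.add_apply] at h1 h2 h3
  rw [h3, integral_add hi₁ hi₂, integral_const_mul] at h1
  rw [integral_add hg₁ hg₂, integral_add (hgi φ hφ1 hφs) (hφi.const_mul _),
    integral_const_mul] at h2
  linarith

/-! ### From test functions to H₀¹ -/

theorem integ_norm_sq {F : Type*} [NormedAddCommGroup F] {Ω : Set (E d)} (f : E d → F) :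
    integ Ω (fun x => ‖f x‖ ^ 2) = eLpNorm f 2 (volume.restrict Ω) ^ 2 := by
  have h := eLpNorm_nnreal_pow_eq_lintegral (f := f) (μ := volume.restrict Ω) (p := 2) two_ne_zero
  norm_num at h
  rw [h, integ]
  refine lintegral_congr fun x => ?_
  rw [ENNReal.ofReal_pow (norm_nonneg _), ofReal_norm]

theorem integ_sq {Ω : Set (E d)} (f : E d → ℝ) :
    integ Ω (fun x => f x ^ 2) = eLpNorm f 2 (volume.restrict Ω) ^ 2 := by
  rw [← integ_norm_sq]; simp

theorem hardySide_eq {Ω : Set (E d)} {v : E d → ℝ}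
    (hv : AEStronglyMeasurable v (volume.restrict Ω)) (L : ℝ) :
    hardySide Ω L v = integ Ω fun x => v x ^ 2 * weight d L x := by
  unfold hardySide integ
  rw [← lintegral_const_mul' _ _ ENNReal.ofReal_ne_top,
    ← lintegral_const_mul' _ _ ENNReal.ofReal_ne_top, ← lintegral_add_left']
  · refine lintegral_congr fun x => ?_
    rw [← ENNReal.ofReal_mul (by positivity), ← ENNReal.ofReal_mul (by positivity),
      ← ENNReal.ofReal_add (by positivity) (by positivity)]
    congr 1
    unfold weight
    ring
  · have : AEMeasurable (fun x : E d => ‖x‖ ^ 2) (volume.restrict Ω) := by fun_prop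
    exact ((hv.aemeasurable.pow_const 2).div this).ennreal_ofReal.const_mul _

theorem measurable_weight (L : ℝ) : Measurable (weight d L) := by
  unfold weight
  fun_prop

theorem integ_eq_ofReal_integral {Ω : Set (E d)} {f : E d → ℝ} (hf : Integrable f)
    (h0 : ∀ x, 0 ≤ f x) (hs : ∀ x ∉ Ω, f x = 0) : integ Ω f = ENNReal.ofReal (∫ x, f x) := by
  rw [integ, ← ofReal_integral_eq_lintegral_ofReal hf.restrict (Eventually.of_forall h0),
    setIntegral_eq_integral_of_forall_compl_eq_zero hs]

theorem IsTestFunction.contDiff_one {Ω : Set (E d)} {φ : E d → ℝ} (hφ : IsTestFunction Ω φ) :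
    ContDiff ℝ 1 φ := hφ.1.of_le (by simp)

theorem IsTestFunction.eq_zero {Ω : Set (E d)} {φ : E d → ℝ} (hφ : IsTestFunction Ω φ) {x : E d}
    (hx : x ∉ Ω) : φ x = 0 :=
  image_eq_zero_of_notMem_tsupport fun h => hx (hφ.2.2 h)

theorem IsTestFunction.gradient_eq_zero {Ω : Set (E d)} {φ : E d → ℝ} (hφ : IsTestFunction Ω φ)
    {x : E d} (hx : x ∉ Ω) : ∇ φ x = 0 := by
  simp [gradient, fderiv_eq_zero_of_notMem_tsupport fun h => hx (hφ.2.2 h)]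

theorem IsTestFunction.integrable_sq {Ω : Set (E d)} {φ : E d → ℝ} (hφ : IsTestFunction Ω φ) :
    Integrable fun x => φ x ^ 2 :=
  (hφ.1.continuous.pow 2).integrable_of_hasCompactSupport
    (hφ.2.1.mono fun x hx h => hx (by simp [h]))

theorem IsTestFunction.integrable_norm_gradient_sq {Ω : Set (E d)} {φ : E d → ℝ}
    (hφ : IsTestFunction Ω φ) : Integrable fun x => ‖∇ φ x‖ ^ 2 :=
  ((continuous_gradient hφ.contDiff_one).norm.pow 2).integrable_of_hasCompactSupport
    ((hasCompactSupport_gradient hφ.2.1).mono fun x hx h => hx (by simp [h]))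

theorem IsLocallyElliptic.exists_integ_le {Ω : Set (E d)} (hΩ : IsLocallyElliptic Ω) :
    ∃ C : ℝ≥0, ∀ L : ℝ, sSup ((fun x => ‖x‖) '' closure Ω) < L →
      ∀ φ : E d → ℝ, IsTestFunction Ω φ → integ Ω (fun x => φ x ^ 2 * weight d L x) ≤
        C * eLpNorm φ 2 (volume.restrict Ω) ^ 2 +
          eLpNorm (∇ φ) 2 (volume.restrict Ω) ^ 2 := by
  obtain ⟨C, hC⟩ := hΩ.exists_integral_le
  refine ⟨C, fun L hL φ hφ => ?_⟩
  obtain ⟨hi, hle⟩ := hC L hL φ hφ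
  rw [← integ_sq, ← integ_norm_sq,
    integ_eq_ofReal_integral hi (fun x => mul_nonneg (sq_nonneg _) (weight_nonneg L x))
      (fun x hx => by simp [hφ.eq_zero hx]),
    integ_eq_ofReal_integral hφ.integrable_sq (fun x => sq_nonneg _)
      (fun x hx => by simp [hφ.eq_zero hx]),
    integ_eq_ofReal_integral hφ.integrable_norm_gradient_sq (fun x => sq_nonneg _)
      (fun x hx => by simp [hφ.gradient_eq_zero hx])]
  refine (ENNReal.ofReal_le_ofReal hle).trans ?_
  rw [ENNReal.ofReal_add (mul_nonneg C.coe_nonneg (integral_nonneg fun x => sq_nonneg _))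
    (integral_nonneg fun x => sq_nonneg _), ENNReal.ofReal_mul C.coe_nonneg]
  simp

/-- Finiteness of the weighted integral is part of the claim, so it is not treated as continuous in
v. Fatou along an almost everywhere convergent subsequence bounds it, while the right-hand side
converges by the triangle inequality in L². -/
theorem IsLocallyElliptic.exists_hardySide_le {Ω : Set (E d)} (hΩ : IsLocallyElliptic Ω) :
    ∃ C : ℝ≥0, ∀ L : ℝ, sSup ((fun x => ‖x‖) '' closure Ω) < L →
      ∀ (v : E d → ℝ) (g : E d → E d), IsH10 Ω v g →
        hardySide Ω L v ≤ C * integ Ω (fun x => v x ^ 2) + integ Ω (fun x => ‖g x‖ ^ 2) := by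
  obtain ⟨C, hC⟩ := hΩ.exists_integ_le
  refine ⟨C, fun L hL v g hvg => ?_⟩
  obtain ⟨⟨hv, hg, -⟩, φ, hφ, hφv, hφg⟩ := hvg
  set μ := volume.restrict Ω with hμ
  have hφm : ∀ k, AEStronglyMeasurable (φ k) μ := fun k => (hφ k).1.continuous.aestronglyMeasurable
  have hφgm : ∀ k, AEStronglyMeasurable (∇ (φ k)) μ := fun k =>
    (continuous_gradient (hφ k).contDiff_one).aestronglyMeasurable
  obtain ⟨ns, hns, hae⟩ := (tendstoInMeasure_of_tendsto_eLpNorm two_ne_zero hφm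
    hv.aestronglyMeasurable hφv).exists_seq_tendsto_ae
  have hbound : ∀ k, integ Ω (fun x => φ (ns k) x ^ 2 * weight d L x) ≤
      C * (eLpNorm (φ (ns k) - v) 2 μ + eLpNorm v 2 μ) ^ 2 +
        (eLpNorm (∇ (φ (ns k)) - g) 2 μ + eLpNorm g 2 μ) ^ 2 := by
    intro k
    refine (hC L hL _ (hφ (ns k))).trans ?_
    have h1 : eLpNorm (φ (ns k)) 2 μ ≤ eLpNorm (φ (ns k) - v) 2 μ + eLpNorm v 2 μ := by
      simpa using eLpNorm_add_le ((hφm (ns k)).sub hv.aestronglyMeasurable)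
        hv.aestronglyMeasurable one_le_two
    have h2 : eLpNorm (∇ (φ (ns k))) 2 μ ≤ eLpNorm (∇ (φ (ns k)) - g) 2 μ + eLpNorm g 2 μ := by
      simpa using eLpNorm_add_le ((hφgm (ns k)).sub hg.aestronglyMeasurable)
        hg.aestronglyMeasurable one_le_two
    gcongr
  have hlim : Tendsto (fun k => C * (eLpNorm (φ (ns k) - v) 2 μ + eLpNorm v 2 μ) ^ 2 +
        (eLpNorm (∇ (φ (ns k)) - g) 2 μ + eLpNorm g 2 μ) ^ 2) atTop
      (𝓝 (C * (0 + eLpNorm v 2 μ) ^ 2 + (0 + eLpNorm g 2 μ) ^ 2)) := by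
    have h1 := (hφv.comp hns.tendsto_atTop).add_const (eLpNorm v 2 μ)
    have h2 := (hφg.comp hns.tendsto_atTop).add_const (eLpNorm g 2 μ)
    exact (ENNReal.Tendsto.const_mul (ENNReal.Tendsto.pow h1)
      (Or.inr ENNReal.coe_ne_top)).add (ENNReal.Tendsto.pow h2)
  rw [hardySide_eq hv.aestronglyMeasurable, integ_sq, integ_norm_sq]
  calc integ Ω (fun x => v x ^ 2 * weight d L x)
      = ∫⁻ x, liminf (fun k => ENNReal.ofReal (φ (ns k) x ^ 2 * weight d L x)) atTop ∂μ := by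
        refine lintegral_congr_ae ?_
        filter_upwards [hae] with x hx
        exact (ENNReal.tendsto_ofReal ((hx.pow 2).mul_const _)).liminf_eq.symm
    _ ≤ liminf (fun k => ∫⁻ x, ENNReal.ofReal (φ (ns k) x ^ 2 * weight d L x) ∂μ) atTop :=
        lintegral_liminf_le' fun k => (((hφm _).aemeasurable.pow_const 2).mul
          (measurable_weight L).aemeasurable).ennreal_ofReal
    _ ≤ liminf (fun k => C * (eLpNorm (φ (ns k) - v) 2 μ + eLpNorm v 2 μ) ^ 2 +
        (eLpNorm (∇ (φ (ns k)) - g) 2 μ + eLpNorm g 2 μ) ^ 2) atTop :=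
        liminf_le_liminf (Eventually.of_forall hbound)
    _ = C * eLpNorm v 2 μ ^ 2 + eLpNorm g 2 μ ^ 2 := by rw [hlim.liminf_eq, zero_add, zero_add]

/-! ### Coordinates and Lipschitz graphs -/

theorem vert_add (x y : E d) : vert (x + y) = vert x + vert y := by simp [vert]

theorem vert_sub (x y : E d) : vert (x - y) = vert x - vert y := by simp [vert]

theorem vert_smul (a : ℝ) (x : E d) : vert (a • x) = a * vert x := by simp [vert]

theorem horiz_add (x y : E d) : horiz (x + y) = horiz x + horiz y := by ext i; simp [horiz]

theorem horiz_sub (x y : E d) : horiz (x - y) = horiz x - horiz y := by ext i; simp [horiz]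

theorem horiz_smul (a : ℝ) (x : E d) : horiz (a • x) = a • horiz x := by ext i; simp [horiz]

theorem horiz_eLast : horiz (eLast d) = 0 := by
  ext i
  simp [horiz, eLast, Fin.castSucc_ne_last]

theorem norm_sq_eq_horiz_add_vert (x : E d) : ‖x‖ ^ 2 = ‖horiz x‖ ^ 2 + vert x ^ 2 := by
  rw [EuclideanSpace.norm_sq_eq, EuclideanSpace.norm_sq_eq, Fin.sum_univ_castSucc]
  simp [horiz, vert]

theorem norm_horiz_le (x : E d) : ‖horiz x‖ ≤ ‖x‖ := by
  refine le_of_sq_le_sq ?_ (norm_nonneg _)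
  rw [norm_sq_eq_horiz_add_vert x]
  nlinarith [sq_nonneg (vert x)]

theorem abs_vert_le (x : E d) : |vert x| ≤ ‖x‖ := by
  refine abs_le_of_sq_le_sq ?_ (norm_nonneg _)
  rw [norm_sq_eq_horiz_add_vert x]
  nlinarith [sq_nonneg ‖horiz x‖]

theorem contDiff_horiz {n : WithTop ℕ∞} : ContDiff ℝ n (horiz : E d → _) := by
  unfold horiz
  rw [contDiff_euclidean]
  intro i
  fun_prop

theorem continuous_vert : Continuous (vert : E d → ℝ) := (contDiff_vert (n := 0)).continuous

theorem continuous_horiz : Continuous (horiz : E d → _) := (contDiff_horiz (n := 0)).continuous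

theorem exists_linearIsometryEquiv_eq_eLast {n : E d} (hn : ‖n‖ = 1) :
    ∃ T : E d ≃ₗᵢ[ℝ] E d, T n = eLast d :=
  ⟨_, Submodule.reflection_sub (hn.trans norm_eLast.symm)⟩

/-- An open set satisfying a uniform cone condition near `p` is, near `p`, the region above a
Lipschitz graph. -/
theorem exists_lipschitz_graph_of_cone {Ω : Set (E d)} (hΩ : IsOpen Ω) {p : E d}
    (hp : p ∈ closure Ω) {r : ℝ} (hr : 0 < r) (T : E d ≃ₗᵢ[ℝ] E d) (K : ℝ≥0)
    (hcone : ∀ q ∈ Ω ∩ Metric.ball p r, ∀ x ∈ Metric.ball p r,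
      K * ‖horiz (T x) - horiz (T q)‖ < vert (T x) - vert (T q) → x ∈ Ω) :
    ∃ φ : EuclideanSpace ℝ (Fin d) → ℝ, LipschitzWith K φ ∧
      ∀ x ∈ Metric.ball p r, x ∈ Ω ↔ φ (horiz (T x)) < vert (T x) := by
  have hne : Nonempty ↥(Ω ∩ Metric.ball p r) := by
    obtain ⟨q, hq, hqΩ⟩ := mem_closure_iff_nhds.1 hp _ (Metric.ball_mem_nhds p hr)
    exact ⟨⟨q, hqΩ, hq⟩⟩
  have hbdd : ∀ y, BddBelow (Set.range fun q : ↥(Ω ∩ Metric.ball p r) =>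
      vert (T q) + K * ‖y - horiz (T q)‖) := by
    intro y
    refine ⟨-(‖p‖ + r), ?_⟩
    rintro _ ⟨⟨q, hq⟩, rfl⟩
    have h1 := (abs_le.1 (abs_vert_le (T q))).1
    have h2 : ‖q‖ ≤ ‖p‖ + r := by
      have := mem_ball_iff_norm.1 hq.2
      have h3 := norm_sub_norm_le q p
      linarith
    have h4 : 0 ≤ K * ‖y - horiz (T q)‖ := by positivity
    rw [T.norm_map] at h1
    simp only
    linarith
  -- The graph function is the lower envelope of the upward cones with apex in Ω, an infimum of
  -- K-Lipschitz functions.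
  refine ⟨fun y => ⨅ q : ↥(Ω ∩ Metric.ball p r), (vert (T q) + K * ‖y - horiz (T q)‖),
    LipschitzWith.of_le_add_mul K fun y z => ?_, fun x hx => ⟨fun hxΩ => ?_, fun h => ?_⟩⟩
  · rw [← sub_le_iff_le_add]
    refine le_ciInf fun q => ?_
    rw [sub_le_iff_le_add]
    refine (ciInf_le (hbdd y) q).trans ?_
    have : ‖y - horiz (T q)‖ ≤ ‖z - horiz (T q)‖ + dist y z := by
      rw [dist_eq_norm]
      calc ‖y - horiz (T q)‖ = ‖(z - horiz (T q)) + (y - z)‖ := by congr 1; abel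
        _ ≤ _ := norm_add_le _ _
    nlinarith [K.coe_nonneg, mul_le_mul_of_nonneg_left this K.coe_nonneg]
  -- A point slightly below x is still in Ω, and the cone with that apex makes the inequality
  -- strict.
  · have hc : Continuous fun t : ℝ => x - t • T.symm (eLast d) := by fun_prop
    have hev : ∀ᶠ t in 𝓝[>] (0 : ℝ), x - t • T.symm (eLast d) ∈ Ω ∩ Metric.ball p r := by
      refine nhdsWithin_le_nhds (hc.continuousAt.eventually_mem ?_)
      simpa using (hΩ.inter Metric.isOpen_ball).mem_nhds ⟨hxΩ, hx⟩
    obtain ⟨t, htΩ, ht⟩ := (hev.and self_mem_nhdsWithin).exists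
    refine (ciInf_le (hbdd _) ⟨_, htΩ⟩).trans_lt ?_
    have ht0 : 0 < t := ht
    simp [vert_sub, vert_smul, horiz_sub, horiz_smul, horiz_eLast, vert_eLast, ht0]
  · obtain ⟨q, hq⟩ := exists_lt_of_ciInf_lt h
    exact hcone q q.2 x hx (by linarith)

/-- An open set that is convex near the point `p` of its closure is, near `p`, the region above
a Lipschitz graph. -/
theorem exists_lipschitz_graph_of_convex {Ω C : Set (E d)} (hΩ : IsOpen Ω) {p c : E d}
    (hp : p ∈ closure Ω) (hC : Convex ℝ C) (hCo : IsOpen C) (hc : c ∈ C) (hcp : c ≠ p)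
    (hloc : ∀ᶠ x in 𝓝 p, x ∈ Ω ↔ x ∈ C) :
    ∃ r > 0, ∃ T : E d ≃ₗᵢ[ℝ] E d, ∃ K : ℝ≥0, ∃ φ : EuclideanSpace ℝ (Fin d) → ℝ,
      LipschitzWith K φ ∧ ∀ x ∈ Metric.ball p r, x ∈ Ω ↔ φ (horiz (T x)) < vert (T x) := by
  obtain ⟨ε, hε, hball⟩ := Metric.isOpen_iff.1 hCo c hc
  obtain ⟨r₀, hr₀, hr₀'⟩ := Metric.eventually_nhds_iff_ball.1 hloc
  set D := ‖c - p‖ with hD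
  have hD0 : 0 < D := norm_pos_iff.2 (sub_ne_zero.2 hcp)
  -- The bound ε/2 leaves room for q ≠ p inside the ball about c; D/2 forces the height s of x over
  -- q to be at most D.
  set r := min r₀ (min (ε / 2) (D / 2)) with hr
  have hrpos : 0 < r := by positivity
  have hr1 : r ≤ r₀ := min_le_left _ _
  have hr2 : r ≤ ε / 2 := (min_le_right _ _).trans (min_le_left _ _)
  have hr3 : r ≤ D / 2 := (min_le_right _ _).trans (min_le_right _ _)
  set n : E d := D⁻¹ • (c - p) with hn
  have hn1 : ‖n‖ = 1 := by
    rw [hn, norm_smul, norm_inv, Real.norm_of_nonneg hD0.le, ← hD, inv_mul_cancel₀ hD0.ne']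
  obtain ⟨T, hT⟩ := exists_linearIsometryEquiv_eq_eLast hn1
  refine ⟨r, hrpos, T, (2 * D / ε).toNNReal, ?_⟩
  refine exists_lipschitz_graph_of_cone hΩ hp hrpos T _ ?_
  rw [Real.coe_toNNReal _ (by positivity)]
  rintro q ⟨hqΩ, hq⟩ x hx hcone
  refine (hr₀' x (Metric.ball_subset_ball hr1 hx)).2 ?_
  have hqC := (hr₀' q (Metric.ball_subset_ball hr1 hq)).1 hqΩ
  rw [← horiz_sub, ← vert_sub, ← map_sub] at hcone
  set s := vert (T (x - q)) with hs
  have hs0 : 0 < s := lt_of_le_of_lt (by positivity) hcone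
  set w : E d := x - q - s • n with hw
  have hTw : T w = T (x - q) - s • eLast d := by rw [hw, map_sub, map_smul, hT]
  have hwn : ‖w‖ = ‖horiz (T (x - q))‖ := by
    have h1 : ‖T w‖ ^ 2 = ‖horiz (T (x - q))‖ ^ 2 := by
      rw [norm_sq_eq_horiz_add_vert, hTw, horiz_sub, vert_sub, horiz_smul, vert_smul, horiz_eLast,
        vert_eLast, ← hs]
      simp
    rw [T.norm_map] at h1
    exact (sq_eq_sq₀ (norm_nonneg _) (norm_nonneg _)).1 h1
  have hsD : s ≤ D := by
    have h1 := (le_abs_self _).trans (abs_vert_le (T (x - q)))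
    rw [T.norm_map, ← hs] at h1
    have h2 : ‖x - q‖ < r + r := by
      rw [← dist_eq_norm]
      exact (dist_triangle_right x q p).trans_lt (add_lt_add hx hq)
    linarith
  -- Prolonging the segment from q through x to height D lands within ε of c: ε/2 comes from q - p
  -- and ε/2 from the slope bound 2D/ε. Then x lies between two points of C.
  have hyC : q + (D / s) • (x - q) ∈ C := by
    refine hball (mem_ball_iff_norm.2 ?_)
    have h1 : q + (D / s) • (x - q) - c = (q - p) + (D / s) • w := by
      have h2 : (D / s) • s • n = c - p := by
        rw [smul_smul, hn, smul_smul]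
        have : D / s * s * D⁻¹ = 1 := by field_simp
        rw [this, one_smul]
      rw [hw, smul_sub (D / s) (x - q), h2]
      abel
    rw [h1]
    refine (norm_add_le _ _).trans_lt ?_
    have h3 : ‖q - p‖ < ε / 2 := (mem_ball_iff_norm.1 hq).trans_le hr2
    have h4 : ‖(D / s) • w‖ < ε / 2 := by
      rw [norm_smul, Real.norm_of_nonneg (by positivity), hwn]
      rw [div_mul_eq_mul_div, div_lt_iff₀ hε] at hcone
      rw [div_mul_eq_mul_div, div_lt_iff₀ hs0]
      linarith
    linarith
  have hx' : x = (1 - s / D) • q + (s / D) • (q + (D / s) • (x - q)) := by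
    rw [smul_add, smul_smul]
    have : s / D * (D / s) = 1 := by field_simp
    rw [this, one_smul, ← add_assoc, ← add_smul]
    simp
  rw [hx']
  exact hC hqC hyC (sub_nonneg.2 ((div_le_one hD0).2 hsD)) (by positivity) (by ring)

/-! ### A locally elliptic domain containing a wide truncated cone -/

/-- The part of the ball of radius `R` that lies above the graph of `h`. -/
def ballAbove (h : EuclideanSpace ℝ (Fin d) → ℝ) (R : ℝ) : Set (E d) :=
  {x | ‖x‖ < R ∧ h (horiz x) < vert x}

theorem isOpen_ballAbove {h : EuclideanSpace ℝ (Fin d) → ℝ} (hh : Continuous h) (R : ℝ) :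
    IsOpen (ballAbove h R) :=
  (isOpen_lt continuous_norm continuous_const).inter
    (isOpen_lt (hh.comp continuous_horiz) continuous_vert)

theorem norm_le_norm_horiz_add {x : E d} (hx : 0 ≤ vert x) : ‖x‖ ≤ ‖horiz x‖ + vert x := by
  refine le_of_sq_le_sq ?_ (by positivity)
  rw [norm_sq_eq_horiz_add_vert x]
  nlinarith [mul_nonneg (norm_nonneg (horiz x)) hx]

theorem convex_ball_inter_vert_gt (R m : ℝ) :
    Convex ℝ {x : E d | ‖x‖ < R ∧ m < vert x} := by
  have h1 : Convex ℝ {x : E d | ‖x‖ < R} := by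
    have h : {x : E d | ‖x‖ < R} = Metric.ball 0 R := by ext x; simp
    exact h ▸ convex_ball (0 : E d) R
  exact h1.inter (convex_halfSpace_gt ⟨vert_add, vert_smul⟩ m)

/-- The upper half-ball is convex and contained in the set, since h ≤ 0. A vertical segment inside
the set joins any other point to it; the height δ is chosen so that |y'| + δ < R. -/
theorem isConnected_ballAbove {h : EuclideanSpace ℝ (Fin d) → ℝ} (h0 : ∀ y, h y ≤ 0)
    {R : ℝ} (hR : 0 < R) : IsConnected (ballAbove h R) := by
  set H : Set (E d) := {x | ‖x‖ < R ∧ 0 < vert x} with hH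
  have hHsub : H ⊆ ballAbove h R := fun x hx => ⟨hx.1, (h0 _).trans_lt hx.2⟩
  have hHc : IsPreconnected H := (convex_ball_inter_vert_gt R 0).isPreconnected
  have hx₀ : (R / 2) • eLast d ∈ H := by
    constructor
    · rw [norm_smul, norm_eLast, Real.norm_of_nonneg (by positivity)]
      linarith
    · rw [vert_smul, vert_eLast]
      linarith
  refine ⟨⟨_, hHsub hx₀⟩, isPreconnected_of_forall ((R / 2) • eLast d) fun y hy => ?_⟩
  by_cases hyv : 0 < vert y
  · exact ⟨H, hHsub, hx₀, ⟨hy.1, hyv⟩, hHc⟩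
  have hyR : ‖horiz y‖ < R := (norm_horiz_le y).trans_lt hy.1
  set δ := (R - ‖horiz y‖) / 2 with hδ
  have hδ0 : 0 < δ := by linarith
  set z : E d := y + (δ - vert y) • eLast d with hz
  have hzv : vert z = δ := by rw [hz, vert_add, vert_smul, vert_eLast]; ring
  have hzh : horiz z = horiz y := by rw [hz, horiz_add, horiz_smul, horiz_eLast]; simp
  have hzH : z ∈ H := by
    refine ⟨?_, by rw [hzv]; exact hδ0⟩
    have := norm_le_norm_horiz_add (x := z) (by rw [hzv]; exact hδ0.le)
    rw [hzv, hzh] at this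
    linarith
  refine ⟨H ∪ segment ℝ y z, Set.union_subset hHsub ?_, Or.inl hx₀,
    Or.inr (left_mem_segment ℝ y z),
    hHc.union z hzH (right_mem_segment ℝ y z) (convex_segment y z).isPreconnected⟩
  rintro _ ⟨a, b, ha, hb, hab, rfl⟩
  have hconv := convex_ball_inter_vert_gt R (h (horiz y)) hy
    (show z ∈ {x : E d | ‖x‖ < R ∧ h (horiz y) < vert x} from
      ⟨hzH.1, (h0 _).trans_lt hzH.2⟩) ha hb hab
  refine ⟨hconv.1, ?_⟩
  have : horiz (a • y + b • z) = horiz y := by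
    rw [horiz_add, horiz_smul, horiz_smul, hzh, ← add_smul, hab, one_smul]
  rw [this]
  exact hconv.2

/-- The part of a ball above a Lipschitz graph that is flat near the sphere has Lipschitz
boundary. -/
theorem hasLipschitzBoundary_ballAbove {h : EuclideanSpace ℝ (Fin d) → ℝ} {K : ℝ≥0}
    (hK : LipschitzWith K h) (h0 : ∀ y, h y ≤ 0) {M ρ R : ℝ} (hM : 0 < M) (hR : 0 < R)
    (hlow : ∀ y, -M ≤ h y) (hout : ∀ y, ρ < ‖y‖ → h y = -M) (hρ : ρ ^ 2 + M ^ 2 < R ^ 2) :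
    HasLipschitzBoundary (ballAbove h R) := by
  intro p hp
  have hopen := isOpen_ballAbove hK.continuous R
  by_cases hpR : ‖p‖ < R
  · refine ⟨R - ‖p‖, by linarith, LinearIsometryEquiv.refl ℝ _, K, h, hK, fun x hx => ?_⟩
    have : ‖x‖ < R := by
      have h1 := mem_ball_iff_norm.1 hx
      have h2 := norm_sub_norm_le x p
      linarith
    simp [ballAbove, this]
  have hcl : p ∈ closure (ballAbove h R) := frontier_subset_closure hp
  have hle : ‖p‖ ≤ R ∧ h (horiz p) ≤ vert p := by
    have : closure (ballAbove h R) ⊆ {x | ‖x‖ ≤ R ∧ h (horiz x) ≤ vert x} := by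
      refine closure_minimal (fun x hx => ⟨hx.1.le, hx.2.le⟩) ?_
      exact (isClosed_le continuous_norm continuous_const).inter
        (isClosed_le (hK.continuous.comp continuous_horiz) continuous_vert)
    exact this hcl
  have hpR' : ‖p‖ = R := le_antisymm hle.1 (not_lt.1 hpR)
  refine exists_lipschitz_graph_of_convex hopen hcl (convex_ball_inter_vert_gt R (-M))
    ((isOpen_lt continuous_norm continuous_const).inter
      (isOpen_lt continuous_const continuous_vert)) (c := 0) ⟨by simpa using hR, ?_⟩ ?_ ?_
  · simpa [vert] using hM
  · rintro rfl
    exact hpR (by simpa using hR)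
  -- On the sphere, either h is locally constant and the set is locally the convex ball cap x_N >
  -- -M, or |p'| ≤ ρ forces x_N > 0 and the set is locally the ball.
  · by_cases hh : ρ < ‖horiz p‖
    · have hev : ∀ᶠ x in 𝓝 p, ρ < ‖horiz x‖ :=
        continuous_horiz.norm.continuousAt.eventually_const_lt hh
      filter_upwards [hev] with x hx
      simp [ballAbove, hout _ hx]
    · have hv : 0 < vert p := by
        by_contra hneg
        have h1 : -M ≤ vert p := (hlow _).trans hle.2
        have h2 := norm_sq_eq_horiz_add_vert p
        rw [hpR'] at h2
        have h3 : ‖horiz p‖ ^ 2 ≤ ρ ^ 2 := by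
          have := norm_nonneg (horiz p)
          nlinarith
        nlinarith
      have hev : ∀ᶠ x in 𝓝 p, 0 < vert x :=
        continuous_vert.continuousAt.eventually_const_lt hv
      filter_upwards [hev] with x hx
      have h1 : h (horiz x) < vert x := (h0 _).trans_lt hx
      have h2 : -M < vert x := by linarith
      simp [ballAbove, h1, h2]

/-- For every truncation of the cone `{x_N ≥ -|x|/2}` there is a locally elliptic domain that
contains it. -/
theorem exists_isLocallyElliptic_superset (hd : 1 ≤ d) {r₁ r₂ : ℝ} (h₁ : 0 < r₁) (h₂ : r₁ ≤ r₂) :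
    ∃ Ω : Set (E d), IsLocallyElliptic Ω ∧
      {x : E d | r₁ ≤ ‖x‖ ∧ ‖x‖ ≤ r₂ ∧ -(‖x‖ / 2) ≤ vert x} ⊆ Ω := by
  let f : ContDiffBump (0 : EuclideanSpace ℝ (Fin d)) :=
    ⟨r₁ / 4, r₁ / 2, by positivity, by linarith⟩
  have hr₂ : 0 < r₂ := h₁.trans_le h₂
  -- The graph is flat at height 0 for |x'| ≤ r₁/4, and at depth r₂ for |x'| ≥ r₁/2, lower than any
  -- point of the truncated cone.
  set h : EuclideanSpace ℝ (Fin d) → ℝ := fun y => r₂ * (f y - 1) with hh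
  have hcd : ContDiff ℝ ∞ h := contDiff_const.mul (f.contDiff.sub contDiff_const)
  have h0 : ∀ y, h y ≤ 0 := fun y =>
    mul_nonpos_of_nonneg_of_nonpos hr₂.le (sub_nonpos.2 f.le_one)
  have hlow : ∀ y, -r₂ ≤ h y := fun y => by
    simp only [hh]
    nlinarith [f.nonneg (x := y)]
  have hout : ∀ y, r₁ / 2 ≤ ‖y‖ → h y = -r₂ := fun y hy => by
    have : f y = 0 := f.zero_of_le_dist (by simpa using hy)
    simp [hh, this]
  have hin : ∀ y, ‖y‖ ≤ r₁ / 4 → h y = 0 := fun y hy => by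
    have : f y = 1 := f.one_of_mem_closedBall (by simpa using hy)
    simp [hh, this]
  obtain ⟨K, hK⟩ : ∃ K, LipschitzWith K h := by
    obtain ⟨K, hK⟩ := ContDiff.lipschitzWith_of_hasCompactSupport f.hasCompactSupport
      (f.contDiff (n := 1)) one_ne_zero
    refine ⟨r₂.toNNReal * K, LipschitzWith.of_le_add_mul _ fun x y => ?_⟩
    have h3 : f x ≤ f y + K * dist x y := by
      have := (abs_le.1 (hK.dist_le_mul x y)).2
      linarith
    simp only [hh]
    rw [NNReal.coe_mul, Real.coe_toNNReal _ hr₂.le]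
    nlinarith [mul_le_mul_of_nonneg_left h3 hr₂.le]
  have hopen := isOpen_ballAbove hK.continuous (2 * r₂)
  have hh0 : h 0 = 0 := hin 0 (by simp; positivity)
  have hvert0 : vert (0 : E d) = 0 := by simp [vert]
  have hhoriz0 : horiz (0 : E d) = 0 := by ext i; simp [horiz]
  have hsub₀ : ∀ x ∈ ballAbove h (2 * r₂), ‖horiz x‖ ≤ r₁ / 4 → 0 < vert x := by
    intro x hx hxs
    have := hx.2
    rwa [hin _ hxs] at this
  refine ⟨ballAbove h (2 * r₂), ⟨hopen, isConnected_ballAbove h0 (by positivity), ?_, ?_, ?_, ?_,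
    ?_, ?_, ?_⟩, ?_⟩
  · refine isBounded_iff_forall_norm_le.2 ⟨2 * r₂, fun x hx => hx.1.le⟩
  · rw [hopen.frontier_eq]
    refine ⟨?_, fun hx => ?_⟩
    · have hc : Continuous fun t : ℝ => t • eLast d := by fun_prop
      have ht : Tendsto (fun t : ℝ => t • eLast d) (𝓝[>] 0) (𝓝 0) := by
        have := hc.tendsto 0
        rw [zero_smul] at this
        exact this.mono_left nhdsWithin_le_nhds
      refine mem_closure_of_tendsto ht ?_
      filter_upwards [Ioo_mem_nhdsGT (show (0 : ℝ) < 2 * r₂ by positivity)] with t ht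
      refine ⟨?_, ?_⟩
      · rw [norm_smul, norm_eLast, Real.norm_of_nonneg ht.1.le, mul_one]
        exact ht.2
      · rw [vert_smul, vert_eLast, mul_one]
        exact (h0 _).trans_lt ht.1
    · have := hx.2
      rw [hhoriz0, hvert0, hh0] at this
      exact lt_irrefl _ this
  · refine hasLipschitzBoundary_ballAbove hK h0 hr₂ (by positivity) hlow
      (ρ := r₁ / 2) (fun y hy => hout y hy.le) ?_
    nlinarith
  · refine ⟨2 * r₂, by positivity, h, hcd, hh0, ?_, fun x hx => ?_⟩
    · have : h =ᶠ[𝓝 0] fun _ => (0 : ℝ) := by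
        filter_upwards [Metric.closedBall_mem_nhds (0 : EuclideanSpace ℝ (Fin d))
          (show 0 < r₁ / 4 by positivity)] with y hy
        exact hin y (by simpa using hy)
      rw [this.fderiv_eq]
      simp
    · have : ‖x‖ < 2 * r₂ := by simpa using hx
      simp [ballAbove, this]
  · intro hsub
    -- A horizontal vector of length r₁, available because N ≥ 2, lies in the domain but not in the
    -- open half-space.
    set i : Fin (d + 1) := (⟨0, hd⟩ : Fin d).castSucc with hi
    set x : E d := r₁ • EuclideanSpace.single i 1 with hx
    have hxn : ‖x‖ = r₁ := by
      rw [hx, norm_smul, Real.norm_of_nonneg h₁.le]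
      simp
    have hxv : vert x = 0 := by
      simp only [hx, vert, hi, PiLp.smul_apply, PiLp.single_apply, smul_eq_mul]
      rw [if_neg (Fin.castSucc_ne_last _).symm, mul_zero]
    have hxh : ‖horiz x‖ = r₁ := by
      have := norm_sq_eq_horiz_add_vert x
      rw [hxv, hxn] at this
      have h3 : r₁ ^ 2 = ‖horiz x‖ ^ 2 := by linarith
      exact ((sq_eq_sq₀ h₁.le (norm_nonneg _)).1 h3).symm
    have hmem : x ∈ ballAbove h (2 * r₂) := by
      refine ⟨by rw [hxn]; linarith, ?_⟩
      rw [hout _ (by rw [hxh]; linarith), hxv]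
      linarith
    have : 0 * ‖horiz x‖ ^ 2 < vert x := hsub hmem
    rw [hxv] at this
    simp at this
  · refine ⟨0, le_rfl, r₁ / 4, by positivity, ?_⟩
    rintro x ⟨hx, hxr⟩
    change 0 * ‖horiz x‖ ^ 2 < vert x
    rw [zero_mul]
    refine hsub₀ x hx ((norm_horiz_le x).trans ?_)
    have : ‖x‖ < r₁ / 4 := by simpa using hxr
    exact this.le
  · refine ⟨-(r₂ / (r₁ / 4) ^ 2), by rw [neg_lt_zero]; positivity, fun x hx => ?_⟩
    change -(r₂ / (r₁ / 4) ^ 2) * ‖horiz x‖ ^ 2 < vert x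
    rcases le_or_gt ‖horiz x‖ (r₁ / 4) with hle | hgt
    · refine lt_of_le_of_lt ?_ (hsub₀ x hx hle)
      have : 0 ≤ r₂ / (r₁ / 4) ^ 2 * ‖horiz x‖ ^ 2 := by positivity
      linarith
    · refine lt_of_le_of_lt ?_ ((hlow _).trans_lt hx.2)
      have h3 : (r₁ / 4) ^ 2 ≤ ‖horiz x‖ ^ 2 := by gcongr
      have : r₂ ≤ r₂ / (r₁ / 4) ^ 2 * ‖horiz x‖ ^ 2 := by
        rw [div_mul_eq_mul_div, le_div_iff₀ (by positivity)]
        gcongr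
      linarith
  · rintro x ⟨hx1, hx2, hxv⟩
    refine ⟨by linarith, ?_⟩
    rcases lt_or_ge 0 (vert x) with hpos | hneg
    · exact (h0 _).trans_lt hpos
    -- From |x_N| ≤ |x|/2 one gets |x'|² ≥ 3|x|²/4 ≥ (r₁/2)².
    · have h3 : r₁ / 2 ≤ ‖horiz x‖ := by
        refine le_of_sq_le_sq ?_ (norm_nonneg _)
        have := norm_sq_eq_horiz_add_vert x
        nlinarith
      rw [hout _ h3]
      linarith

/-! ### One-variable profiles -/

/-- A smooth angular profile supported in `[-1/2, ∞)` that is a strict subsolution. -/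
theorem exists_angular_profile : ∃ (Y : ℝ → ℝ) (c : ℝ), 0 < c ∧ ContDiff ℝ ∞ Y ∧
    (∀ s ≤ -(1 / 2), Y s = 0) ∧ (∀ s, 0 ≤ deriv Y s ∧ deriv Y s ≤ 1) ∧ 0 < Y 0 ∧
    ∀ s ≤ 1, Y s * (s - Y s) ≤ -c * Y s ^ 2 := by
  set τ : ℝ → ℝ := fun t => Real.smoothTransition (2 * t + 1) with hτ
  have hτc : ContDiff ℝ ∞ τ := Real.smoothTransition.contDiff.comp (by fun_prop)
  have hτ0 : ∀ t ≤ -(1 / 2), τ t = 0 := fun t ht =>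
    Real.smoothTransition.zero_of_nonpos (by linarith)
  have hτ1 : ∀ t, 0 ≤ t → τ t = 1 := fun t ht => Real.smoothTransition.one_of_one_le (by linarith)
  -- The half-space profile s, shifted upward and smoothly cut off: Y = s + Y(0) for s ≥ 0.
  set Y : ℝ → ℝ := fun s => ∫ t in (-(1 / 2))..s, τ t with hY
  have hd : ∀ s, HasDerivAt Y (τ s) s := fun s =>
    hτc.continuous.integral_hasStrictDerivAt _ s |>.hasDerivAt
  have hderiv : deriv Y = τ := funext fun s => (hd s).deriv
  have hYc : ContDiff ℝ ∞ Y :=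
    contDiff_infty_iff_deriv.2 ⟨fun s => (hd s).differentiableAt, hderiv ▸ hτc⟩
  have hYz : ∀ s ≤ -(1 / 2), Y s = 0 := by
    intro s hs
    have : Set.EqOn τ (fun _ => 0) (Set.uIcc (-(1 / 2)) s) := by
      intro t ht
      rw [Set.uIcc_of_ge hs] at ht
      exact hτ0 t ht.2
    simp only [hY]
    rw [intervalIntegral.integral_congr this]
    simp
  have hbnd : ∀ s, 0 ≤ deriv Y s ∧ deriv Y s ≤ 1 := fun s => by
    rw [hderiv]
    exact ⟨Real.smoothTransition.nonneg _, Real.smoothTransition.le_one _⟩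
  have hmono : Monotone Y :=
    monotone_of_deriv_nonneg (fun s => (hd s).differentiableAt) fun s => (hbnd s).1
  have hYnn : ∀ s, 0 ≤ Y s := fun s => by
    rcases le_total s (-(1 / 2)) with h | h
    · exact (hYz s h).ge
    · exact (hYz _ le_rfl).ge.trans (hmono h)
  have hYpos : 0 < Y 0 := by
    refine intervalIntegral.intervalIntegral_pos_of_pos_on
      (hτc.continuous.intervalIntegrable _ _) ?_ (by norm_num)
    intro t ht
    exact Real.smoothTransition.pos_of_pos (by linarith [ht.1])
  have hYlin : ∀ s, 0 ≤ s → Y s = s + Y 0 := by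
    intro s hs
    have h1 : Y s = Y 0 + ∫ t in (0)..s, τ t :=
      (intervalIntegral.integral_add_adjacent_intervals
        (hτc.continuous.intervalIntegrable _ _) (hτc.continuous.intervalIntegrable _ _)).symm
    have : Set.EqOn τ (fun _ => 1) (Set.uIcc 0 s) := by
      intro t ht
      rw [Set.uIcc_of_le hs] at ht
      exact hτ1 t ht.1
    rw [h1, intervalIntegral.integral_congr this]
    simp
    ring
  -- For s ≥ 0 the condition reads c ≤ Y(0)/(s + Y(0)), which is tightest at s = 1; for s ≤ 0 it
  -- suffices that c ≤ 1.
  refine ⟨Y, Y 0 / (1 + Y 0), by positivity, hYc, hYz, hbnd, hYpos, fun s hs => ?_⟩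
  have hc1 : Y 0 / (1 + Y 0) ≤ 1 := (div_le_one (by positivity)).2 (by linarith)
  rcases le_total s 0 with h | h
  · have h2 := mul_le_mul_of_nonneg_right hc1 (sq_nonneg (Y s))
    have h3 := mul_nonpos_of_nonneg_of_nonpos (hYnn s) h
    nlinarith
  · rw [hYlin s h, neg_mul, div_mul_eq_mul_div, ← neg_div, le_div_iff₀ (by positivity)]
    have : 0 ≤ Y 0 * (s + Y 0) * (1 - s) := by
      have : 0 ≤ 1 - s := by linarith
      positivity
    nlinarith

/-- Smooth cutoffs on the line with arbitrarily small Rayleigh quotient `κ`; the function `G` is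
a primitive of `ψ'² - κ ψ²`. -/
theorem exists_radial_profile {k : ℝ} (hk : 0 < k) : ∃ (ψ G : ℝ → ℝ) (κ τ : ℝ), κ < k ∧ 1 < τ ∧
    ContDiff ℝ ∞ ψ ∧ ContDiff ℝ ∞ G ∧ Function.support ψ ⊆ Set.Icc 1 τ ∧
    Function.support G ⊆ Set.Icc 1 τ ∧ (∃ t, ψ t ≠ 0) ∧
    ∀ t, deriv G t = deriv ψ t ^ 2 - κ * ψ t ^ 2 := by
  let f : ContDiffBump (3 : ℝ) := ⟨1, 2, one_pos, one_lt_two⟩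
  have hf : ContDiff ℝ ∞ f := f.contDiff
  have hf0 : ∀ t, t ∉ Set.Ioo (1 : ℝ) 5 → f t = 0 := by
    intro t ht
    refine f.zero_of_le_dist ?_
    rw [Real.dist_eq]
    by_contra hcon
    have := abs_lt.1 (not_le.1 hcon)
    have e : f.rOut = 2 := rfl
    rw [e] at this
    exact ht ⟨by linarith [this.1], by linarith [this.2]⟩
  have hf' : ContDiff ℝ ∞ (deriv f) := (contDiff_infty_iff_deriv.1 hf).2
  have hderiv0 : ∀ t, t ∉ Set.Icc (1 : ℝ) 5 → deriv f t = 0 := by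
    intro t ht
    have : f =ᶠ[𝓝 t] fun _ => (0 : ℝ) := by
      filter_upwards [isClosed_Icc.isOpen_compl.mem_nhds ht] with y hy
      exact hf0 y fun h => hy ⟨h.1.le, h.2.le⟩
    rw [this.deriv_eq]
    simp
  set I₀ := ∫ t in (1 : ℝ)..5, f t ^ 2 with hI₀
  set I₁ := ∫ t in (1 : ℝ)..5, deriv f t ^ 2 with hI₁
  have hI₀pos : 0 < I₀ := by
    refine intervalIntegral.intervalIntegral_pos_of_pos_on
      ((hf.continuous.pow 2).intervalIntegrable _ _) ?_ (by norm_num)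
    intro t ht
    have : 0 < f t := f.pos_of_mem_ball (by
      rw [Metric.mem_ball, Real.dist_eq]
      exact abs_lt.2 ⟨by linarith [ht.1], by linarith [ht.2]⟩)
    positivity
  -- With the exact Rayleigh quotient of f, the integrand g has total integral zero, so its
  -- primitive is again compactly supported.
  set κ₀ := I₁ / I₀ with hκ₀
  set g : ℝ → ℝ := fun t => deriv f t ^ 2 - κ₀ * f t ^ 2 with hg
  have hgc : ContDiff ℝ ∞ g := (hf'.pow 2).sub (contDiff_const.mul (hf.pow 2))
  have hg0 : ∀ t, t ∉ Set.Icc (1 : ℝ) 5 → g t = 0 := by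
    intro t ht
    simp [hg, hderiv0 t ht, hf0 t fun h => ht ⟨h.1.le, h.2.le⟩]
  have hint : ∫ t in (1 : ℝ)..5, g t = 0 := by
    have h1 : IntervalIntegrable (fun t => deriv f t ^ 2) volume 1 5 :=
      (hf'.continuous.pow 2).intervalIntegrable _ _
    have h2 : IntervalIntegrable (fun t => κ₀ * f t ^ 2) volume 1 5 :=
      (continuous_const.mul (hf.continuous.pow 2)).intervalIntegrable _ _
    simp only [hg]
    rw [intervalIntegral.integral_sub h1 h2, intervalIntegral.integral_const_mul, ← hI₀, ← hI₁, hκ₀]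
    field_simp
    ring
  set G₀ : ℝ → ℝ := fun s => ∫ t in (1 : ℝ)..s, g t with hG₀
  have hG₀d : ∀ s, HasDerivAt G₀ (g s) s := fun s =>
    hgc.continuous.integral_hasStrictDerivAt _ s |>.hasDerivAt
  have hG₀c : ContDiff ℝ ∞ G₀ := by
    refine contDiff_infty_iff_deriv.2 ⟨fun s => (hG₀d s).differentiableAt, ?_⟩
    rwa [funext fun s => (hG₀d s).deriv]
  have hG₀z : ∀ s, s ∉ Set.Icc (1 : ℝ) 5 → G₀ s = 0 := by
    intro s hs
    rcases lt_or_ge s 1 with h | h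
    · have : Set.EqOn g (fun _ => 0) (Set.uIoo 1 s) := by
        intro t ht
        rw [Set.uIoo_of_ge h.le] at ht
        exact hg0 t fun h' => absurd h'.1 (not_le.2 ht.2)
      simp only [hG₀]
      rw [intervalIntegral.integral_congr_uIoo this]
      simp
    · have h5 : 5 < s := by
        by_contra hcon
        exact hs ⟨h, not_lt.1 hcon⟩
      have h1 : G₀ s = (∫ t in (1 : ℝ)..5, g t) + ∫ t in (5 : ℝ)..s, g t :=
        (intervalIntegral.integral_add_adjacent_intervals
          (hgc.continuous.intervalIntegrable _ _) (hgc.continuous.intervalIntegrable _ _)).symm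
      have : Set.EqOn g (fun _ => 0) (Set.uIoo 5 s) := by
        intro t ht
        rw [Set.uIoo_of_le h5.le] at ht
        exact hg0 t fun h' => absurd h'.2 (not_le.2 ht.1)
      rw [h1, hint, intervalIntegral.integral_congr_uIoo this]
      simp
  -- Dilation by T divides the Rayleigh quotient by T²; T ≥ 1 keeps the support to the right of 1.
  obtain ⟨T, hT1, hTk⟩ : ∃ T : ℝ, 1 ≤ T ∧ κ₀ / T ^ 2 < k := by
    refine ⟨1 + |κ₀| / k, by simp; positivity, ?_⟩
    have hpos : 0 < 1 + |κ₀| / k := by positivity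
    rw [div_lt_iff₀ (by positivity)]
    have h1 : |κ₀| / k * k = |κ₀| := by field_simp
    have h2 : 0 ≤ |κ₀| / k := by positivity
    have h3 := le_abs_self κ₀
    nlinarith [mul_nonneg hk.le h2, mul_nonneg hk.le (sq_nonneg (|κ₀| / k))]
  have hT0 : 0 < T := by linarith
  have hsc : ContDiff ℝ ∞ fun t : ℝ => t / T := by fun_prop
  have hscd : ∀ t : ℝ, HasDerivAt (fun t : ℝ => t / T) (1 / T) t := fun t =>
    (hasDerivAt_id t).div_const T
  have hmem : ∀ t : ℝ, t ∉ Set.Icc 1 (5 * T) → t / T ∉ Set.Icc (1 : ℝ) 5 := by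
    intro t ht h
    refine ht ⟨?_, (div_le_iff₀ hT0).1 h.2⟩
    have := (le_div_iff₀ hT0).1 h.1
    linarith
  refine ⟨fun t => f (t / T), fun t => T⁻¹ * G₀ (t / T), κ₀ / T ^ 2, 5 * T, hTk, by linarith,
    hf.comp hsc, contDiff_const.mul (hG₀c.comp hsc), ?_, ?_, ⟨3 * T, ?_⟩, fun t => ?_⟩
  · intro t ht
    by_contra h
    exact ht (hf0 _ fun h' => hmem t h ⟨h'.1.le, h'.2.le⟩)
  · intro t ht
    by_contra h
    exact ht (by simp [hG₀z _ (hmem t h)])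
  · have : 3 * T / T = 3 := by field_simp
    simp only [this]
    exact (f.pos_of_mem_ball (by simp [f])).ne'
  · have h1 : HasDerivAt (fun t => f (t / T)) (deriv f (t / T) * (1 / T)) t :=
      HasDerivAt.comp (h₂ := f) (h := fun t => t / T) t
        ((hf.differentiable (by simp)) (t / T)).hasDerivAt (hscd t)
    have h2 : HasDerivAt (fun t => T⁻¹ * G₀ (t / T)) (T⁻¹ * (g (t / T) * (1 / T))) t :=
      ((hG₀d (t / T)).comp t (hscd t)).const_mul _
    rw [h1.deriv, h2.deriv]
    simp only [hg]
    field_simp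

/-! ### Functions of x_N/|x| and log|x|, and integration by parts for them -/

/-- A function of the form `A(x_N / |x|) B(log |x|)`. -/
noncomputable def axial (d : ℕ) (A B : ℝ → ℝ) (x : E d) : ℝ :=
  A (vert x / ‖x‖) * B (Real.log ‖x‖)

section axial

variable {A B : ℝ → ℝ} {τ : ℝ}

/-- A support in [1, τ] also excludes x = 0, where `Real.log` takes the default value 0. -/
theorem norm_bounds_of_log_support (hB : Function.support B ⊆ Set.Icc 1 τ) {x : E d}
    (hx : B (Real.log ‖x‖) ≠ 0) : Real.exp 1 ≤ ‖x‖ ∧ ‖x‖ ≤ Real.exp τ := by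
  obtain ⟨h1, h2⟩ := hB hx
  have hpos : 0 < ‖x‖ := by
    rcases (norm_nonneg x).eq_or_lt with h | h
    · rw [← h, Real.log_zero] at h1
      linarith
    · exact h
  exact ⟨(Real.le_log_iff_exp_le hpos).1 h1, (Real.log_le_iff_le_exp hpos).1 h2⟩

theorem tsupport_axial_subset (hB : Function.support B ⊆ Set.Icc 1 τ) :
    tsupport (axial d A B) ⊆ {x | Real.exp 1 ≤ ‖x‖ ∧ ‖x‖ ≤ Real.exp τ} := by
  refine closure_minimal (fun x hx => norm_bounds_of_log_support hB (right_ne_zero_of_mul hx)) ?_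
  exact (isClosed_le continuous_const continuous_norm).inter
    (isClosed_le continuous_norm continuous_const)

theorem hasCompactSupport_axial (hB : Function.support B ⊆ Set.Icc 1 τ) :
    HasCompactSupport (axial d A B) :=
  HasCompactSupport.of_support_subset_isCompact (isCompact_closedBall 0 (Real.exp τ))
    fun x hx => by simpa using (norm_bounds_of_log_support hB (right_ne_zero_of_mul hx)).2

theorem contDiff_axial {n : WithTop ℕ∞} (hA : ContDiff ℝ n A) (hBc : ContDiff ℝ n B)
    (hB : Function.support B ⊆ Set.Icc 1 τ) : ContDiff ℝ n (axial d A B) := by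
  refine contDiff_iff_contDiffAt.2 fun x => ?_
  by_cases hx : x ∈ tsupport (axial d A B)
  · have hpos : 0 < ‖x‖ := (Real.exp_pos 1).trans_le (tsupport_axial_subset hB hx).1
    have hn := contDiffAt_norm (n := n) ℝ (norm_pos_iff.1 hpos)
    exact (hA.contDiffAt.comp x (contDiff_vert.contDiffAt.div hn hpos.ne')).mul
      (hBc.contDiffAt.comp x (hn.log hpos.ne'))
  · exact contDiffAt_const.congr_of_eventuallyEq (notMem_tsupport_iff_eventuallyEq.1 hx)

theorem hasFDerivAt_axial {A' B' : ℝ} {x : E d} (hx : x ≠ 0)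
    (hA : HasDerivAt A A' (vert x / ‖x‖)) (hB : HasDerivAt B B' (Real.log ‖x‖)) :
    HasFDerivAt (axial d A B) (innerSL ℝ
      ((A' * B (Real.log ‖x‖) / ‖x‖) • (eLast d - (vert x / ‖x‖ ^ 2) • x) +
        (A (vert x / ‖x‖) * B' / ‖x‖ ^ 2) • x)) x := by
  have hpos : 0 < ‖x‖ := norm_pos_iff.2 hx
  have h1 : HasFDerivAt (fun y : E d => vert y / ‖y‖) _ x :=
    (hasFDerivAt_vert x).fun_mul (hasFDerivAt_comp_norm hx (hasDerivAt_inv hpos.ne'))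
  have h2 : HasFDerivAt (fun y : E d => Real.log ‖y‖) _ x :=
    hasFDerivAt_comp_norm hx (Real.hasDerivAt_log hpos.ne')
  refine ((hA.comp_hasFDerivAt x h1).fun_mul (hB.comp_hasFDerivAt x h2)).congr_fderiv ?_
  ext y
  simp only [Function.comp_apply, add_apply, smul_apply, innerSL_apply_apply, smul_eq_mul,
    inner_add_left, inner_sub_left, inner_smul_left, conj_trivial]
  field_simp
  ring

theorem fderiv_axial (hA : Differentiable ℝ A) (hB : Differentiable ℝ B) {x : E d} (hx : x ≠ 0)
    (y : E d) : fderiv ℝ (axial d A B) x y =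
      deriv A (vert x / ‖x‖) * B (Real.log ‖x‖) / ‖x‖ * (vert y - vert x / ‖x‖ ^ 2 * ⟪x, y⟫) +
        A (vert x / ‖x‖) * deriv B (Real.log ‖x‖) / ‖x‖ ^ 2 * ⟪x, y⟫ := by
  rw [(hasFDerivAt_axial hx (hA _).hasDerivAt (hB _).hasDerivAt).fderiv]
  simp [inner_eLast]

theorem norm_gradient_axial_sq (hA : Differentiable ℝ A) (hB : Differentiable ℝ B) {x : E d}
    (hx : x ≠ 0) : ‖∇ (axial d A B) x‖ ^ 2 =
      (deriv A (vert x / ‖x‖) ^ 2 * B (Real.log ‖x‖) ^ 2 * (1 - (vert x / ‖x‖) ^ 2) +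
        A (vert x / ‖x‖) ^ 2 * deriv B (Real.log ‖x‖) ^ 2) / ‖x‖ ^ 2 := by
  have hpos : 0 < ‖x‖ := norm_pos_iff.2 hx
  rw [norm_gradient, (hasFDerivAt_axial hx (hA _).hasDerivAt (hB _).hasDerivAt).fderiv,
    innerSL_apply_norm, norm_add_sq_real]
  simp only [norm_smul, norm_sub_sq_real, inner_sub_left, inner_smul_left,
    inner_smul_right, inner_eLast, real_inner_self_eq_norm_sq, norm_eLast, mul_pow,
    Real.norm_eq_abs, sq_abs, conj_trivial]
  field_simp
  ring

end axial

theorem exp_neg_mul_log {x : E d} (hx : x ≠ 0) :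
    Real.exp (-Real.log ‖x‖) = ‖x‖⁻¹ := by
  rw [Real.exp_neg, Real.exp_log (norm_pos_iff.2 hx)]

/-- The homogeneous weight `A(s) g(t) |x|^{-N}`, with `s = x_N / |x|` and `t = log |x|`. -/
noncomputable def density (d : ℕ) (A g : ℝ → ℝ) : E d → ℝ :=
  axial d A fun t => Real.exp (-((d + 1) * t)) * g t

section density

variable {A G : ℝ → ℝ} {τ : ℝ}

theorem support_exp_mul_subset {S : Set ℝ} {e g : ℝ → ℝ} (hg : Function.support g ⊆ S) :
    Function.support (fun t => e t * g t) ⊆ S :=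
  fun _ ht => hg (right_ne_zero_of_mul ht)

theorem support_deriv_subset_Icc (hG : Function.support G ⊆ Set.Icc 1 τ) :
    Function.support (deriv G) ⊆ Set.Icc 1 τ :=
  support_deriv_subset.trans (closure_minimal hG isClosed_Icc)

theorem integrable_density (hA : Continuous A) (hG : Continuous G)
    (hs : Function.support G ⊆ Set.Icc 1 τ) : Integrable (density d A G) := by
  have h1 : ContDiff ℝ 0 (density d A G) := by
    refine contDiff_axial (contDiff_zero.2 hA) (contDiff_zero.2 (by fun_prop))
      (support_exp_mul_subset hs)
  exact h1.continuous.integrable_of_hasCompactSupport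
    (hasCompactSupport_axial (support_exp_mul_subset hs))

theorem density_zero (hs : Function.support G ⊆ Set.Icc 1 τ) : density d A G 0 = 0 := by
  by_contra h
  simp only [density, axial] at h
  have := (norm_bounds_of_log_support hs (right_ne_zero_of_mul (right_ne_zero_of_mul h))).1
  rw [norm_zero] at this
  exact absurd this (not_le.2 (Real.exp_pos 1))

/-- Replaces the radial integration in polar coordinates: the integrand is the divergence of x times
A(s) G(t) |x|^(-N). -/
theorem integral_density_deriv (hA : ContDiff ℝ 1 A) (hG : ContDiff ℝ 1 G)
    (hs : Function.support G ⊆ Set.Icc 1 τ) : ∫ x, density d A (deriv G) x = 0 := by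
  have hB : ContDiff ℝ 1 fun t => Real.exp (-(((d : ℝ) + 1) * t)) * G t := by fun_prop
  have hs' := support_exp_mul_subset (e := fun t => Real.exp (-(((d : ℝ) + 1) * t))) hs
  have h := integral_euler (contDiff_axial (d := d) hA hB hs') (hasCompactSupport_axial hs')
  rw [← h]
  refine integral_congr_ae (Eventually.of_forall fun x => ?_)
  rcases eq_or_ne x 0 with rfl | hx
  · have h1 := density_zero (d := d) (A := A) hs
    simp only [density_zero (support_deriv_subset_Icc hs), map_zero, add_zero]
    unfold density at h1
    rw [h1, mul_zero]
  have hpos : 0 < ‖x‖ := norm_pos_iff.2 hx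
  have hd : ∀ t, HasDerivAt (fun t => Real.exp (-(((d : ℝ) + 1) * t)) * G t)
      (Real.exp (-(((d : ℝ) + 1) * t)) * (deriv G t - (d + 1) * G t)) t := by
    intro t
    have h1 : HasDerivAt (fun t => -(((d : ℝ) + 1) * t)) (-((d + 1) * 1)) t :=
      ((hasDerivAt_id t).const_mul _).neg
    refine (h1.exp.mul (hG.differentiable one_ne_zero t).hasDerivAt).congr_deriv ?_
    ring
  simp only
  rw [fderiv_axial (hA.differentiable one_ne_zero) (hB.differentiable one_ne_zero) hx,
    (hd _).deriv, real_inner_self_eq_norm_sq]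
  unfold density axial
  field_simp
  ring

/-- Replaces integration by parts on the sphere: the integrand is the x_N-derivative of A(s) G(t)
|x|^(-d). Its first summand carries the spherical divergence of A times the tangential part of e_N,
its second a radial derivative. -/
theorem integral_density_vert (hA : ContDiff ℝ 1 A) (hG : ContDiff ℝ 1 G)
    (hs : Function.support G ⊆ Set.Icc 1 τ) :
    ∫ x, (density d (fun s => (1 - s ^ 2) * deriv A s - d * (s * A s)) G x +
      density d (fun s => s * A s) (deriv G) x) = 0 := by
  have hB : ContDiff ℝ 1 fun t => Real.exp (-((d : ℝ) * t)) * G t := by fun_prop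
  have hs' := support_exp_mul_subset (e := fun t => Real.exp (-((d : ℝ) * t))) hs
  have h := integral_fderiv_apply_eq_zero (contDiff_axial (d := d) hA hB hs')
    (hasCompactSupport_axial hs') (eLast d)
  rw [← h]
  refine integral_congr_ae (Eventually.of_forall fun x => ?_)
  rcases eq_or_ne x 0 with rfl | hx
  · have h1 : (0 : E d) ∉ tsupport (axial d A fun t => Real.exp (-((d : ℝ) * t)) * G t) := by
      intro h0
      have := (tsupport_axial_subset hs' h0).1
      rw [norm_zero] at this
      exact absurd this (not_le.2 (Real.exp_pos 1))
    simp only [density_zero (support_deriv_subset_Icc hs), density_zero hs,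
      fderiv_eq_zero_of_notMem_tsupport h1]
    simp
  have hpos : 0 < ‖x‖ := norm_pos_iff.2 hx
  have hd : ∀ t, HasDerivAt (fun t => Real.exp (-((d : ℝ) * t)) * G t)
      (Real.exp (-((d : ℝ) * t)) * (deriv G t - d * G t)) t := by
    intro t
    have h1 : HasDerivAt (fun t => -((d : ℝ) * t)) (-(d * 1)) t :=
      ((hasDerivAt_id t).const_mul _).neg
    refine (h1.exp.mul (hG.differentiable one_ne_zero t).hasDerivAt).congr_deriv ?_
    ring
  have he : Real.exp (-(((d : ℝ) + 1) * Real.log ‖x‖)) =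
      Real.exp (-((d : ℝ) * Real.log ‖x‖)) * ‖x‖⁻¹ := by
    rw [← exp_neg_mul_log hx, ← Real.exp_add]
    congr 1
    ring
  simp only
  rw [fderiv_axial (hA.differentiable one_ne_zero) (hB.differentiable one_ne_zero) hx,
    (hd _).deriv, real_inner_comm, inner_eLast, vert_eLast]
  unfold density axial
  simp only [he]
  field_simp
  ring

end density

/-! ### The function violating the inequality -/

/-- In a truncated cone slightly larger than a half-space, the Hardy constant `N² / 4` fails. -/
theorem exists_axial_integral_lt (hd : 1 ≤ d) : ∃ (v : E d → ℝ) (r₁ r₂ : ℝ),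
    0 < r₁ ∧ r₁ ≤ r₂ ∧
    IsTestFunction {x : E d | r₁ ≤ ‖x‖ ∧ ‖x‖ ≤ r₂ ∧ -(‖x‖ / 2) ≤ vert x} v ∧
    Integrable (fun x => v x ^ 2 / ‖x‖ ^ 2) ∧
    ∫ x, ‖∇ v x‖ ^ 2 < ((d : ℝ) + 1) ^ 2 / 4 * ∫ x, v x ^ 2 / ‖x‖ ^ 2 := by
  obtain ⟨Y, c, hc, hY, hY0, hY', hYpos, hYc⟩ := exists_angular_profile
  obtain ⟨ψ, G, κ, τ, hκ, hτ, hψ, hG, hψs, hGs, ⟨t₀, ht₀⟩, hGd⟩ := exists_radial_profile hc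
  -- This is the factor |x|^(-(N-2)/2), critical for the Hardy inequality in the whole space.
  set e : ℝ → ℝ := fun t => Real.exp (-(((d : ℝ) - 1) / 2 * t)) with he
  set B : ℝ → ℝ := fun t => e t * ψ t with hB
  have hec : ContDiff ℝ ∞ e := by fun_prop
  have hBc : ContDiff ℝ ∞ B := hec.mul hψ
  have hBs : Function.support B ⊆ Set.Icc 1 τ := support_exp_mul_subset hψs
  set v : E d → ℝ := axial d Y B with hv
  have hvc : ContDiff ℝ ∞ v := contDiff_axial hY hBc hBs
  have hvs : HasCompactSupport v := hasCompactSupport_axial hBs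
  have hY1 : ContDiff ℝ 1 Y := hY.of_le (by simp)
  have hψ1 : ContDiff ℝ 1 ψ := hψ.of_le (by simp)
  have hψ2s : Function.support (fun t => ψ t ^ 2) ⊆ Set.Icc 1 τ := fun t ht =>
    hψs fun h => ht (by simp [h])
  have hdv : ∀ x : E d, v x ^ 2 / ‖x‖ ^ 2 =
      density d (fun s => Y s ^ 2) (fun t => ψ t ^ 2) x := by
    intro x
    rcases eq_or_ne x 0 with rfl | hx
    · rw [density_zero hψ2s]; simp
    have hpos : 0 < ‖x‖ := norm_pos_iff.2 hx
    have h1 : e (Real.log ‖x‖) ^ 2 * (‖x‖ ^ 2)⁻¹ = Real.exp (-((d + 1) * Real.log ‖x‖)) := by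
      rw [← inv_pow, ← exp_neg_mul_log hx, he, ← Real.exp_nat_mul, ← Real.exp_nat_mul,
        ← Real.exp_add]
      congr 1
      push_cast
      ring
    simp only [hv, density, axial, hB, ← h1]
    ring
  have hvi : Integrable (fun x => v x ^ 2 / ‖x‖ ^ 2) := by
    simp_rw [hdv]
    exact integrable_density (hY.continuous.pow 2) (hψ.continuous.pow 2) hψ2s
  refine ⟨v, Real.exp 1, Real.exp τ, Real.exp_pos 1, Real.exp_le_exp.2 hτ.le,
    ⟨hvc, hvs, ?_⟩, hvi, ?_⟩
  · refine closure_minimal (fun x hx => ?_) ?_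
    · obtain ⟨h1, h2⟩ := norm_bounds_of_log_support hBs (right_ne_zero_of_mul hx)
      refine ⟨h1, h2, ?_⟩
      by_contra hcon
      refine left_ne_zero_of_mul hx (hY0 _ ?_)
      rw [div_le_iff₀ ((Real.exp_pos 1).trans_le h1)]
      linarith
    · exact (isClosed_le continuous_const continuous_norm).inter
        ((isClosed_le continuous_norm continuous_const).inter
          (isClosed_le (continuous_norm.div_const 2).neg continuous_vert))
  set ψ2 : ℝ → ℝ := fun t => ψ t ^ 2 with hψ2
  have hψ2c : ContDiff ℝ 1 ψ2 := hψ1.pow 2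
  have hψ2d : ∀ t, deriv ψ2 t = 2 * ψ t * deriv ψ t := fun t => by
    have := ((hψ1.differentiable one_ne_zero t).hasDerivAt.fun_pow 2).deriv
    simpa using this
  have hY2c : ContDiff ℝ 1 fun s => Y s ^ 2 := hY1.pow 2
  have hsYc : ContDiff ℝ 1 fun s => s * Y s := contDiff_id.mul hY1
  have hG1 : ContDiff ℝ 1 G := hG.of_le (by simp)
  have hY'c : Continuous (deriv Y) := hY1.continuous_deriv le_rfl
  have hZ₀ := integral_density_vert (d := d) hY1 hψ2c hψ2s
  have hZ₁ := integral_density_deriv (d := d) hY2c hψ2c hψ2s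
  have hZ₂ := integral_density_deriv (d := d) hsYc hψ2c hψ2s
  have hZ₃ := integral_density_deriv (d := d) hY2c hG1 hGs
  have hi₀ : Integrable fun x => density d (fun s => (1 - s ^ 2) * deriv Y s - d * (s * Y s)) ψ2 x +
      density d (fun s => s * Y s) (deriv ψ2) x :=
    (integrable_density (by fun_prop) hψ2c.continuous hψ2s).add
      (integrable_density hsYc.continuous (hψ2c.continuous_deriv le_rfl)
        (support_deriv_subset_Icc hψ2s))
  have hi₁ : Integrable (density d (fun s => Y s ^ 2) (deriv ψ2)) :=
    integrable_density hY2c.continuous (hψ2c.continuous_deriv le_rfl)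
      (support_deriv_subset_Icc hψ2s)
  have hi₂ : Integrable (density d (fun s => s * Y s) (deriv ψ2)) :=
    integrable_density hsYc.continuous (hψ2c.continuous_deriv le_rfl)
      (support_deriv_subset_Icc hψ2s)
  have hi₃ : Integrable (density d (fun s => Y s ^ 2) (deriv G)) :=
    integrable_density hY2c.continuous (hG1.continuous_deriv le_rfl)
      (support_deriv_subset_Icc hGs)
  have hgi : Integrable fun x => ‖∇ v x‖ ^ 2 :=
    IsTestFunction.integrable_norm_gradient_sq (Ω := Set.univ) ⟨hvc, hvs, Set.subset_univ _⟩
  have hd1 : (1 : ℝ) ≤ d := by exact_mod_cast hd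
  -- Every term in the last bracket integrates to zero, and (d-1)²/4 + d = (d+1)²/4. The angular
  -- gain c exceeds the radial cost κ.
  have key : ∀ x, ‖∇ v x‖ ^ 2 ≤ (((d : ℝ) + 1) ^ 2 / 4 - (c - κ)) * (v x ^ 2 / ‖x‖ ^ 2) +
      ((density d (fun s => (1 - s ^ 2) * deriv Y s - d * (s * Y s)) ψ2 x +
        density d (fun s => s * Y s) (deriv ψ2) x) -
      ((d : ℝ) - 1) / 2 * density d (fun s => Y s ^ 2) (deriv ψ2) x -
      density d (fun s => s * Y s) (deriv ψ2) x +
      density d (fun s => Y s ^ 2) (deriv G) x) := by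
    intro x
    rcases eq_or_ne x 0 with rfl | hx
    · have h1 : (0 : E d) ∉ tsupport v := by
        intro h0
        have := (tsupport_axial_subset hBs h0).1
        rw [norm_zero] at this
        exact absurd this (not_le.2 (Real.exp_pos 1))
      rw [hdv, density_zero hψ2s, density_zero hψ2s,
        density_zero (support_deriv_subset_Icc hψ2s),
        density_zero (support_deriv_subset_Icc hψ2s),
        density_zero (support_deriv_subset_Icc hGs), norm_gradient,
        fderiv_eq_zero_of_notMem_tsupport h1]
      simp
    have hpos : 0 < ‖x‖ := norm_pos_iff.2 hx
    have hBd : ∀ t, HasDerivAt B (e t * (deriv ψ t - ((d : ℝ) - 1) / 2 * ψ t)) t := by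
      intro t
      have h1 : HasDerivAt (fun t => -(((d : ℝ) - 1) / 2 * t)) (-(((d : ℝ) - 1) / 2 * 1)) t :=
        ((hasDerivAt_id t).const_mul _).neg
      refine (h1.exp.mul (hψ1.differentiable one_ne_zero t).hasDerivAt).congr_deriv ?_
      simp only [he]
      ring
    have h1 : e (Real.log ‖x‖) ^ 2 = Real.exp (-((d + 1) * Real.log ‖x‖)) * ‖x‖ ^ 2 := by
      have : ‖x‖ ^ 2 = Real.exp (2 * Real.log ‖x‖) := by
        rw [two_mul, Real.exp_add, Real.exp_log hpos, sq]
      rw [this, he, ← Real.exp_nat_mul, ← Real.exp_add]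
      congr 1
      push_cast
      ring
    rw [hdv, norm_gradient_axial_sq (hY1.differentiable one_ne_zero)
      (hBc.differentiable (by simp)) hx, (hBd _).deriv]
    simp only [density, axial, hB, hψ2d, hGd]
    set s := vert x / ‖x‖ with hs
    set t := Real.log ‖x‖ with ht
    have hs1 : |s| ≤ 1 := by
      rw [hs, abs_div, abs_norm]
      exact div_le_one_of_le₀ (abs_vert_le x) (norm_nonneg x)
    have hss : 0 ≤ 1 - s ^ 2 := by
      have := (sq_le_one_iff_abs_le_one s).2 hs1
      linarith
    set D := Real.exp (-(((d : ℝ) + 1) * t)) with hD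
    have hDpos : 0 < D := Real.exp_pos _
    have hlhs : (deriv Y s ^ 2 * (e t * ψ t) ^ 2 * (1 - s ^ 2) +
        Y s ^ 2 * (e t * (deriv ψ t - ((d : ℝ) - 1) / 2 * ψ t)) ^ 2) / ‖x‖ ^ 2 =
        D * (deriv Y s ^ 2 * ψ t ^ 2 * (1 - s ^ 2) +
        Y s ^ 2 * (deriv ψ t - ((d : ℝ) - 1) / 2 * ψ t) ^ 2) := by
      rw [mul_pow, mul_pow, h1]
      field_simp
    rw [hlhs, ← sub_nonneg]
    -- The discarded terms: Y'² ≤ Y' makes the angular energy linear in Y'. Of the d copies of -Y(s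
    -- - Y) ≥ 0, one supplies the gain c Y² and the others are dropped.
    have hgap : 0 ≤ D * ψ t ^ 2 * ((deriv Y s - deriv Y s ^ 2) * (1 - s ^ 2) +
        (d - 1) * (-(Y s * (s - Y s))) + (-c * Y s ^ 2 - Y s * (s - Y s))) := by
      have a1 : 0 ≤ deriv Y s - deriv Y s ^ 2 := by
        have := hY' s
        nlinarith [mul_nonneg this.1 (sub_nonneg.2 this.2)]
      have a2 := hYc s (abs_le.1 hs1).2
      have a3 : 0 ≤ -(Y s * (s - Y s)) := by nlinarith [mul_nonneg hc.le (sq_nonneg (Y s))]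
      have a4 : 0 ≤ -c * Y s ^ 2 - Y s * (s - Y s) := sub_nonneg.2 a2
      have a5 : (0 : ℝ) ≤ d - 1 := by linarith
      positivity
    refine hgap.trans (le_of_eq ?_)
    simp only [hψ2]
    ring
  have hint : ∫ x, ‖∇ v x‖ ^ 2 ≤
      (((d : ℝ) + 1) ^ 2 / 4 - (c - κ)) * ∫ x, v x ^ 2 / ‖x‖ ^ 2 := by
    have hs₁ := hi₁.const_mul (((d : ℝ) - 1) / 2)
    have h1 := integral_mono hgi ((hvi.const_mul _).add
      (((hi₀.sub hs₁).sub hi₂).add hi₃)) key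
    have h2 := integral_add (hvi.const_mul (((d : ℝ) + 1) ^ 2 / 4 - (c - κ)))
      (((hi₀.sub hs₁).sub hi₂).add hi₃)
    have h3 := integral_add ((hi₀.sub hs₁).sub hi₂) hi₃
    have h4 := integral_sub (hi₀.sub hs₁) hi₂
    have h5 := integral_sub hi₀ hs₁
    simp only [Pi.add_apply, Pi.sub_apply] at h1 h2 h3 h4 h5
    rw [h2, h3, h4, h5, hZ₀, hZ₂, hZ₃, integral_const_mul, integral_const_mul, hZ₁] at h1
    linarith
  have hpos : 0 < ∫ x, v x ^ 2 / ‖x‖ ^ 2 := by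
    have hcont : Continuous fun x => v x ^ 2 / ‖x‖ ^ 2 := by
      simp_rw [hdv]
      exact (contDiff_axial (contDiff_zero.2 hY2c.continuous)
        (contDiff_zero.2 (by fun_prop)) (support_exp_mul_subset hψ2s)).continuous
    refine hcont.integral_pos_of_hasCompactSupport_nonneg_nonzero ?_ (fun x => by positivity)
      (x := Real.exp t₀ • EuclideanSpace.single (⟨0, by omega⟩ : Fin (d + 1)) (1 : ℝ)) ?_
    · exact hvs.mono fun x hx h => hx (by simp [h])
    · set x : E d := Real.exp t₀ • EuclideanSpace.single (⟨0, by omega⟩ : Fin (d + 1)) (1 : ℝ)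
        with hx
      have hn : ‖x‖ = Real.exp t₀ := by
        rw [hx, norm_smul, Real.norm_of_nonneg (Real.exp_pos _).le]
        simp
      have hxv : vert x = 0 := by
        simp only [hx, vert, PiLp.smul_apply, PiLp.single_apply, smul_eq_mul]
        rw [if_neg (by simp [Fin.ext_iff]; omega), mul_zero]
      have hvx : v x ≠ 0 := by
        simp only [hv, axial, hn, hxv, Real.log_exp, zero_div, hB]
        have := Real.exp_pos (-(((d : ℝ) - 1) / 2 * t₀))
        exact mul_ne_zero hYpos.ne' (mul_ne_zero this.ne' ht₀)
      rw [hn]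
      have := Real.exp_pos t₀
      positivity
  have : 0 < (c - κ) * ∫ x, v x ^ 2 / ‖x‖ ^ 2 := mul_pos (sub_pos.2 hκ) hpos
  linarith

/-! ### Failure without the L² term -/

theorem IsTestFunction.mono {Ω Ω' : Set (E d)} {φ : E d → ℝ} (hφ : IsTestFunction Ω φ)
    (h : Ω ⊆ Ω') : IsTestFunction Ω' φ :=
  ⟨hφ.1, hφ.2.1, hφ.2.2.trans h⟩

theorem integral_gradient_eq_zero {u : E d → ℝ} (hu : ContDiff ℝ 1 u)
    (hc : HasCompactSupport u) : ∫ x, ∇ u x = 0 := by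
  have hi : Integrable (∇ u) :=
    (continuous_gradient hu).integrable_of_hasCompactSupport (hasCompactSupport_gradient hc)
  refine ext_inner_left ℝ fun y => ?_
  rw [← integral_inner hi, inner_zero_right]
  have h : ∀ x, ⟪y, ∇ u x⟫ = fderiv ℝ u x y := fun x => by
    rw [real_inner_comm, inner_gradient_left]
  simp_rw [h]
  exact integral_fderiv_apply_eq_zero hu hc y

theorem IsTestFunction.isH1 {Ω : Set (E d)} {v : E d → ℝ} (hv : IsTestFunction Ω v) :
    IsH1 Ω v (∇ v) := by
  have hvg := hasCompactSupport_gradient hv.2.1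
  have hvc := continuous_gradient hv.contDiff_one
  refine ⟨(hv.1.continuous.memLp_of_hasCompactSupport hv.2.1).restrict Ω,
    (hvc.memLp_of_hasCompactSupport hvg).restrict Ω, fun φ hφ => ?_⟩
  have hφc := continuous_gradient hφ.contDiff_one
  rw [setIntegral_eq_integral_of_forall_compl_eq_zero fun x hx => by rw [hv.eq_zero hx, zero_smul],
    setIntegral_eq_integral_of_forall_compl_eq_zero fun x hx => by rw [hφ.eq_zero hx, zero_smul],
    ← add_eq_zero_iff_eq_neg, ← integral_add]
  · rw [← integral_gradient_eq_zero (hv.contDiff_one.mul hφ.contDiff_one) hv.2.1.mul_right]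
    refine integral_congr_ae (Eventually.of_forall fun x => ?_)
    exact (gradient_fun_mul (hv.contDiff_one.differentiable one_ne_zero x)
      (hφ.contDiff_one.differentiable one_ne_zero x)).symm
  · exact (hv.1.continuous.smul hφc).integrable_of_hasCompactSupport hv.2.1.smul_right
  · exact (hφ.1.continuous.smul hvc).integrable_of_hasCompactSupport hφ.2.1.smul_right

theorem IsTestFunction.isH10 {Ω : Set (E d)} {v : E d → ℝ} (hv : IsTestFunction Ω v) :
    IsH10 Ω v (∇ v) :=
  ⟨hv.isH1, fun _ => v, fun _ => hv, by simp, by simp⟩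

theorem exists_hardySide_gt (hd : 1 ≤ d) : ∃ Ω : Set (E d), IsLocallyElliptic Ω ∧
    ∃ (v : E d → ℝ) (g : E d → E d), IsH10 Ω v g ∧
      ∀ L : ℝ, integ Ω (fun x => ‖g x‖ ^ 2) < hardySide Ω L v := by
  obtain ⟨v, r₁, r₂, h₁, h₂, hv, hvi, hlt⟩ := exists_axial_integral_lt hd
  obtain ⟨Ω, hΩ, hsub⟩ := exists_isLocallyElliptic_superset hd h₁ h₂
  have hvΩ := hv.mono hsub
  refine ⟨Ω, hΩ, v, ∇ v, hvΩ.isH10, fun L => ?_⟩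
  -- The logarithmic term is dropped: the N²/4 term alone already exceeds the Dirichlet energy,
  -- whatever L is.
  refine lt_of_lt_of_le ?_ le_self_add
  rw [integ_eq_ofReal_integral hvΩ.integrable_norm_gradient_sq (fun x => sq_nonneg _)
      (fun x hx => by simp [hvΩ.gradient_eq_zero hx]),
    integ_eq_ofReal_integral hvi (fun x => by positivity)
      (fun x hx => by simp [hvΩ.eq_zero hx]),
    ← ENNReal.ofReal_mul (by positivity)]
  exact (ENNReal.ofReal_lt_ofReal_iff_of_nonneg (integral_nonneg fun x => sq_nonneg _)).2 hlt

end BoundaryHardy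

/-- Here `N = d + 1 ≥ 2`. -/
theorem theorem2p3 (d : ℕ) (hd : 1 ≤ d) :
    (∀ Ω : Set (BoundaryHardy.E d), BoundaryHardy.IsLocallyElliptic Ω →
      ∃ C : ℝ≥0, ∀ L : ℝ, sSup ((fun x => ‖x‖) '' closure Ω) < L →
        ∀ (v : BoundaryHardy.E d → ℝ) (g : BoundaryHardy.E d → BoundaryHardy.E d),
          BoundaryHardy.IsH10 Ω v g →
            BoundaryHardy.hardySide Ω L v ≤
              C * BoundaryHardy.integ Ω (fun x => v x ^ 2) +
                BoundaryHardy.integ Ω (fun x => ‖g x‖ ^ 2)) ∧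
    (∃ Ω : Set (BoundaryHardy.E d), BoundaryHardy.IsLocallyElliptic Ω ∧
      ∃ (v : BoundaryHardy.E d → ℝ) (g : BoundaryHardy.E d → BoundaryHardy.E d),
        BoundaryHardy.IsH10 Ω v g ∧
          ∀ L : ℝ, sSup ((fun x => ‖x‖) '' closure Ω) < L →
            BoundaryHardy.integ Ω (fun x => ‖g x‖ ^ 2) < BoundaryHardy.hardySide Ω L v) := by
  refine ⟨fun Ω hΩ => hΩ.exists_hardySide_le, ?_⟩
  obtain ⟨Ω, hΩ, v, g, hvg, h⟩ := BoundaryHardy.exists_hardySide_gt hd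
  exact ⟨Ω, hΩ, v, g, hvg, fun L _ => h L⟩
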